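/- Let the \emph{rank} of a finite group $G$ be the least integer $r \ge 0$ such that every subgroup of $G$ can be generated by at most $r$ elements. Let $F(G)$ denote the Fitting subgroup of $G$ (the subgroup generated by all nilpotent normal subgroups) and $\Phi(G)$ the Frattini subgroup. A finite group is \emph{of affine cyclic type}, written $\mathrm{Aff}(E,C)$, if it is a semidirect product $E \rtimes C$, where for some prime $p$ the group $E$ is an elementary abelian $p$-group, and $C$ is a cyclic group of prime power order with $p \nmid |C|$ acting faithfully on $E$. A \emph{section} of $G$ is a quotient of a subgroup of $G$. There is a function $f:\mathbb{N}\to\mathbb{N}$ such that for every integer $r\ge 0$ and every finite soluble group $G$ of rank $r$, the group $G/F(G)$ has an abelian normal subgroup $A$ with $$|A|\le |F(G)/\Phi(G)| \quad\text{and}\quad |(G/F(G)):A|\le f(r),$$ and such that, moreover, for every integer $T \ge 0$: if $G$ has no section isomorphic to a group $\mathrm{Aff}(E,C)$ of affine cyclic type with $|C|>T$, then $|A|\le (T!)^r$. -/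

import Mathlib

universe u

/-- The rank of a finite group `G`: the least `n` such that every subgroup of `G` can be generated
by at most `n` elements. -/
noncomputable def subgroupRank (G : Type u) [Group G] : ℕ :=
  sInf {n : ℕ | ∀ H : Subgroup G, ∃ S : Finset G, S.card ≤ n ∧ Subgroup.closure (S : Set G) = H}

/-- The Fitting subgroup `F(G)`: the subgroup generated by all nilpotent normal subgroups of `G`. -/
def fittingSubgroup (G : Type u) [Group G] : Subgroup G :=
  sSup {N : Subgroup G | N.Normal ∧ Group.IsNilpotent N}

instance fittingSubgroup_normal (G : Type u) [Group G] : (fittingSubgroup G).Normal :=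
  Subgroup.sSup_normal _ fun _ h => h.1

/-- The group `Q` is (isomorphic to) a section of `G`, that is, a quotient of a subgroup of `G`. -/
def IsSectionOf (Q : Type u) [Group Q] (G : Type u) [Group G] : Prop :=
  ∃ (H : Subgroup G) (N : Subgroup H) (_ : N.Normal), Nonempty (H ⧸ N ≃* Q)

/-- The semidirect product `E ⋊[φ] C` is a group `Aff(E, C)` of affine cyclic type: for some
prime `p`, the group `E` is a finite elementary abelian `p`-group, and `C` is a cyclic group of
prime power order, prime to `p`, that acts faithfully on `E` through `φ`. -/
structure IsAffineCyclicType {E C : Type u} [Group E] [Group C] (φ : C →* MulAut E) : Prop where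
  finite_left : Finite E
  comm_left : ∀ x y : E, x * y = y * x
  exists_prime : ∃ p : ℕ, p.Prime ∧ (∀ x : E, x ^ p = 1) ∧ ¬ p ∣ Nat.card C
  isCyclic_right : IsCyclic C
  isPrimePow_right : IsPrimePow (Nat.card C)
  faithful : Function.Injective φ

open Subgroup

/-! Write `F = F(G)`, `Φ = Φ(G)`, `W = F/Φ` and `B = G/F`. For finite soluble `G` the group `W` is
abelian and `B` acts on it faithfully (`fittingAction_injective`). The action is semisimple: a
maximal subgroup `M` of `G` not containing `F` yields the maximal invariant subgroup `(M ∩ F)/Φ` of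
`W`, and these intersect trivially by the definition of `Φ`. The corresponding quotients of `W` form
a jointly faithful family of irreducible actions of `B` on elementary abelian groups of rank at most
`r`. The primes vary and the number of factors is not bounded. Any maximal abelian normal subgroup
`A` of `B` works.

Order of `A`: by Clifford's theorem `W` stays semisimple under `A`, and an abelian group acting
irreducibly on `V` modulo its kernel has order at most `|V|`; multiplying over independent factors
gives `|A| ≤ |W|` (`card_le_of_comm_of_maxInvariant`). For the bound `(T!)^r`, an element of `A`
acts on each factor with order prime to the characteristic, and each prime power dividing that order
gives a section of affine cyclic type, so the order divides `T!`. Thus `A` is abelian of rank at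
most `r` and exponent dividing `T!`.

Index of `A`: on a factor of order at most `p ^ r`, commuting elements of order prime to `p`
generate a reduced commutative subalgebra of the endomorphism ring, which has at most `r ^ 2`
characters over the algebraic closure. A group normalizing the set of these elements permutes the
characters, and the permutation action decides how it acts on the elements
(`exists_hom_perm_of_commute`). So conjugation on such a set is controlled by homomorphisms to
`Sym(r ^ 2)`, whose common exponent and soluble length replace any bound on the number of factors.
Applied to `A` this bounds `|B : C(A)|`. Applied to the cosets of `A` in a normal subgroup `N` that
is maximal with `A ≤ N ≤ C(A)` and `[N, N] ≤ A`, it bounds `|N : A|`, and then `|C(A) : C(N)|`;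
solubility gives `C(N) ≤ A` (`IsFaithfulIrreducibleFamily.index_le`). -/

/-- Every subgroup of `G` can be generated by at most `r` elements. -/
def HasRankLE (G : Type*) [Group G] (r : ℕ) : Prop :=
  ∀ H : Subgroup G, ∃ S : Finset G, S.card ≤ r ∧ closure (S : Set G) = H

theorem hasRankLE_subgroupRank (G : Type*) [Group G] [Finite G] :
    HasRankLE G (subgroupRank G) := by
  classical
  refine Nat.sInf_mem (s := {n : ℕ | ∀ H : Subgroup G, ∃ S : Finset G, S.card ≤ n ∧
    closure (S : Set G) = H}) ⟨Nat.card G, fun H => ?_⟩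
  refine ⟨(H : Set G).toFinite.toFinset, ?_, by simp⟩
  rw [← Set.ncard_eq_toFinset_card, ← Nat.card_coe_set_eq]
  exact Subgroup.card_le_card_group H

/-! ### Rank of subgroups and quotients; order from rank and exponent. -/

namespace HasRankLE

variable {G Q : Type*} [Group G] [Group Q] {r : ℕ}

theorem of_surjective (h : HasRankLE G r) (f : G →* Q) (hf : Function.Surjective f) :
    HasRankLE Q r := by
  classical
  intro H
  obtain ⟨S, hS, hc⟩ := h (H.comap f)
  refine ⟨S.image f, Finset.card_image_le.trans hS, ?_⟩
  rw [Finset.coe_image, ← MonoidHom.map_closure, hc, map_comap_eq_self_of_surjective hf]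

theorem of_injective (h : HasRankLE G r) (f : Q →* G) (hf : Function.Injective f) :
    HasRankLE Q r := by
  classical
  intro H
  obtain ⟨S, hS, hc⟩ := h (H.map f)
  refine ⟨S.preimage f hf.injOn, ?_, ?_⟩
  · refine (Finset.card_le_card_of_injOn f ?_ hf.injOn).trans hS
    intro x hx
    simpa using hx
  · apply map_injective hf
    rw [MonoidHom.map_closure, Finset.coe_preimage, Set.image_preimage_eq_of_subset, hc]
    intro x hx
    have : x ∈ H.map f := hc ▸ subset_closure hx
    obtain ⟨y, -, rfl⟩ := this
    exact ⟨y, rfl⟩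

theorem subgroup (h : HasRankLE G r) (H : Subgroup G) : HasRankLE H r :=
  h.of_injective H.subtype H.subtype_injective

theorem quotient (h : HasRankLE G r) (H : Subgroup G) [H.Normal] : HasRankLE (G ⧸ H) r :=
  h.of_surjective (QuotientGroup.mk' H) (QuotientGroup.mk'_surjective H)

theorem card_le_of_comm [Finite G] (h : HasRankLE G r) (hc : ∀ x y : G, x * y = y * x) {e : ℕ}
    (he : 0 < e) (hG : ∀ x : G, x ^ e = 1) : Nat.card G ≤ e ^ r := by
  let : CommGroup G := { (inferInstance : Group G) with mul_comm := hc }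
  refine (Nat.le_of_dvd (pow_pos he _) (card_dvd_exponent_pow_rank' G hG)).trans
    (Nat.pow_le_pow_right he ?_)
  obtain ⟨S, hS, hS'⟩ := h ⊤
  exact (Group.rank_le hS').trans hS

/-- The order of the quotient of `N` by a subgroup `A` containing its derived subgroup and
its `e`-th powers. -/
theorem relIndex_le [Finite G] (h : HasRankLE G r) {A N : Subgroup G}
    (hc : ⁅N, N⁆ ≤ A) {e : ℕ} (he : 0 < e) (hN : ∀ x ∈ N, x ^ e ∈ A) :
    A.relIndex N ≤ e ^ r := by
  have : (A.subgroupOf N).Normal := by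
    refine ⟨fun a ha n => ?_⟩
    rw [mem_subgroupOf] at *
    have h1 := hc (commutator_mem_commutator n.2 a.2)
    rw [commutatorElement_def] at h1
    simpa using A.mul_mem h1 ha
  refine ((h.subgroup N).quotient (A.subgroupOf N)).card_le_of_comm ?_ he ?_
  · intro x y
    induction x using QuotientGroup.induction_on with | H x =>
    induction y using QuotientGroup.induction_on with | H y =>
    rw [← QuotientGroup.mk_mul, ← QuotientGroup.mk_mul, QuotientGroup.eq, mem_subgroupOf]
    have h1 := hc (commutator_mem_commutator (inv_mem y.2) (inv_mem x.2))
    rw [commutatorElement_def] at h1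
    simpa [mul_assoc] using h1
  · intro x
    induction x using QuotientGroup.induction_on with | H x =>
    rw [← QuotientGroup.mk_pow, QuotientGroup.eq_one_iff, mem_subgroupOf]
    exact hN x x.2

/-- Each factor of the derived series is abelian of rank at most `r` and exponent dividing `e`, so
it contributes at most `e ^ r`. -/
theorem card_le_of_derivedSeries [Finite G] (h : HasRankLE G r) {e : ℕ}
    (he : 0 < e) (hG : ∀ x : G, x ^ e = 1) {d : ℕ} (hd : derivedSeries G d = ⊥) :
    Nat.card G ≤ (e ^ r) ^ d := by
  have key : ∀ k, (derivedSeries G k).index ≤ (e ^ r) ^ k := by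
    intro k
    induction k with
    | zero => simp
    | succ k ih =>
      rw [← relIndex_mul_index (derivedSeries_antitone (G := G) (Nat.le_succ k)), pow_succ, mul_comm]
      refine Nat.mul_le_mul ih (h.relIndex_le le_rfl he ?_)
      intro x _
      rw [hG x]
      exact one_mem _
  have := key d
  rwa [hd, index_bot] at this

end HasRankLE

/-! ### Derived series and commutators in soluble groups. -/

theorem derivedSeries_card_eq_bot (G : Type*) [Group G] [Finite G] [Group.IsSolvable G] {n : ℕ}
    (hn : Nat.card G ≤ n) : derivedSeries G n = ⊥ := by
  have key : ∀ k, derivedSeries G k = ⊥ ∨ Nat.card (derivedSeries G k) + k ≤ Nat.card G := by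
    intro k
    induction k with
    | zero => right; simp
    | succ k ih =>
      by_cases hb : derivedSeries G k = ⊥
      · left
        rw [derivedSeries_succ, hb, commutator_bot_left]
      · right
        have h1 := Group.IsSolvable.commutator_lt_of_ne_bot hb
        rw [← derivedSeries_succ] at h1
        have h2 : Nat.card (derivedSeries G (k + 1)) < Nat.card (derivedSeries G k) := by
          simpa [← Nat.card_coe_set_eq] using Set.ncard_lt_ncard (SetLike.coe_ssubset_coe.2 h1) (Set.toFinite _)
        have h3 := ih.resolve_left hb
        omega
  rcases key n with h | h
  · exact h
  · have : 0 < Nat.card (derivedSeries G n) := Nat.card_pos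
    omega

/-- A homomorphism to a finite group kills the derived series of a soluble group after at most as
many steps as the order of the target. -/
theorem derivedSeries_le_ker {G H : Type*} [Group G] [Group H] [Finite H] [Group.IsSolvable G]
    (f : G →* H) {n : ℕ} (hn : Nat.card H ≤ n) : derivedSeries G n ≤ f.ker := by
  have : Group.IsSolvable f.range := Group.isSolvable_of_surjective f.rangeRestrict_surjective
  have h1 : derivedSeries f.range n = ⊥ :=
    derivedSeries_card_eq_bot _ ((Subgroup.card_le_card_group f.range).trans hn)
  have h2 := map_derivedSeries_le_derivedSeries f.rangeRestrict n
  rw [h1, Subgroup.map_le_iff_le_comap] at h2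
  intro x hx
  have := h2 hx
  rw [mem_comap, mem_bot] at this
  exact congrArg Subtype.val this

/-- A soluble normal subgroup not contained in `A` contains a normal subgroup that is not contained
in `A` but is abelian modulo `A`. -/
theorem exists_normal_commutator_le {G : Type*} [Group G] [Group.IsSolvable G] {A D : Subgroup G}
    [D.Normal] (hDA : ¬ D ≤ A) :
    ∃ M : Subgroup G, M.Normal ∧ M ≤ D ∧ ¬ M ≤ A ∧ ⁅M, M⁆ ≤ A := by
  obtain ⟨s, hs0, hs⟩ : ∃ s : ℕ → Subgroup G, s 0 = D ∧ ∀ k, s (k + 1) = ⁅s k, s k⁆ :=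
    ⟨fun k => (fun K : Subgroup G => ⁅K, K⁆)^[k] D, rfl,
      fun k => Function.iterate_succ_apply' _ _ _⟩
  have hn : ∀ k, (s k).Normal ∧ s k ≤ D := by
    intro k
    induction k with
    | zero => exact ⟨hs0 ▸ ‹D.Normal›, hs0.le⟩
    | succ k ih =>
      have := ih.1
      have h := Subgroup.commutator_normal (s k) (s k)
      rw [hs]
      exact ⟨h, (commutator_le_left (s k) (s k)).trans ih.2⟩
  have hle : ∀ k, s k ≤ derivedSeries G k := by
    intro k
    induction k with
    | zero => exact le_top
    | succ k ih => rw [hs]; exact commutator_mono ih ih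
  have hex : ∃ k, s k ≤ A := by
    obtain ⟨n, hn⟩ := (‹Group.IsSolvable G›).solvable
    exact ⟨n, (hle n).trans (hn ▸ bot_le)⟩
  classical
  -- `s` is the derived series of `D`; the required subgroup is its last term outside `A`.
  have hpos : Nat.find hex ≠ 0 := fun h0 => hDA (by simpa [h0, hs0] using Nat.find_spec hex)
  obtain ⟨k, hk⟩ := Nat.exists_eq_succ_of_ne_zero hpos
  refine ⟨s k, (hn k).1, (hn k).2, Nat.find_min hex (by omega), ?_⟩
  have := Nat.find_spec hex
  rwa [hk, Nat.succ_eq_add_one, hs] at this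

theorem commutator_le_iff_le_comap_centralizer {G : Type*} [Group G] {M K L : Subgroup G}
    [L.Normal] : ⁅M, K⁆ ≤ L ↔
      M ≤ (centralizer (K.map (QuotientGroup.mk' L) : Set (G ⧸ L))).comap (QuotientGroup.mk' L) := by
  rw [← map_le_iff_le_comap, ← commutator_eq_bot_iff_le_centralizer, ← map_commutator,
    Subgroup.map_eq_bot_iff, QuotientGroup.ker_mk']

theorem commutator_sup_le {G : Type*} [Group G] {M N K L : Subgroup G} [L.Normal]
    (hM : ⁅M, K⁆ ≤ L) (hN : ⁅N, K⁆ ≤ L) : ⁅M ⊔ N, K⁆ ≤ L :=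
  commutator_le_iff_le_comap_centralizer.2 (sup_le (commutator_le_iff_le_comap_centralizer.1 hM)
    (commutator_le_iff_le_comap_centralizer.1 hN))

/-! ### Characters of commuting automorphisms of order prime to `p`. -/

section Semisimple

variable {p : ℕ} [Fact p.Prime]

/-- In a commutative algebra over `ZMod p` generated by elements of order prime to `p`, every
nilpotent element vanishes. -/
theorem isReduced_of_adjoin_eq_top {R : Type*} [CommRing R] [Algebra (ZMod p) R] {X : Set R}
    (hX : Algebra.adjoin (ZMod p) X = ⊤) {m : ℕ} (hm : p.Coprime m) (hXm : ∀ x ∈ X, x ^ m = 1) :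
    IsReduced R := by
  rcases subsingleton_or_nontrivial R with hR | hR
  · exact isReduced_of_subsingleton
  have : CharP R p := charP_of_injective_algebraMap (algebraMap (ZMod p) R).injective p
  have : ExpChar R p := ExpChar.prime Fact.out
  let k := m.totient
  have hk0 : 0 < k := by
    refine Nat.totient_pos.2 (Nat.pos_of_ne_zero ?_)
    rintro rfl
    exact (Fact.out : p.Prime).ne_one (by simpa using hm)
  have hk : p ^ k ≡ 1 [MOD m] := Nat.ModEq.pow_totient hm
  obtain ⟨c, hc⟩ : m ∣ p ^ k - 1 := (Nat.modEq_iff_dvd' (Nat.one_le_pow _ _ (Fact.out : p.Prime).pos)).1 hk.symm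
  have hpk : p ^ k = m * c + 1 := by
    have := Nat.one_le_pow k p (Fact.out : p.Prime).pos
    omega
  -- The `p ^ k`-power map is a ring homomorphism fixing scalars and generators, hence every
  -- element. Iterating it writes `x` as an arbitrarily high power of itself, which rules out
  -- nonzero nilpotents.
  have hfrob : ∀ x : R, x ^ p ^ k = x := by
    intro x
    have hx : x ∈ Algebra.adjoin (ZMod p) X := hX ▸ Algebra.mem_top
    induction hx using Algebra.adjoin_induction with
    | mem x hx => rw [hpk, pow_succ, pow_mul, hXm x hx, one_pow, one_mul]
    | algebraMap a => rw [← map_pow, ZMod.pow_card_pow]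
    | add x y _ _ hx hy => rw [add_pow_expChar_pow, hx, hy]
    | mul x y _ _ hx hy => rw [mul_pow, hx, hy]
  refine ⟨fun x hx => ?_⟩
  have h1 : ∀ j, x ^ (p ^ k) ^ j = x := by
    intro j
    induction j with
    | zero => simp
    | succ j ih => rw [pow_succ, pow_mul, ih, hfrob]
  obtain ⟨n, hn⟩ := hx
  have h2 : n ≤ (p ^ k) ^ n :=
    (Nat.lt_pow_self (Nat.one_lt_pow hk0.ne' (Fact.out : p.Prime).one_lt)).le
  rw [← h1 n]
  exact pow_eq_zero_of_le h2 hn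

theorem isReduced_of_range_eq_adjoin {R E : Type*} [CommRing R] [Algebra (ZMod p) R] [Ring E]
    [Algebra (ZMod p) E] {ι : R →ₐ[ZMod p] E} (hι : Function.Injective ι) {Y : Set E}
    (hY : ι.range = Algebra.adjoin (ZMod p) Y) {m : ℕ} (hm : p.Coprime m)
    (hYm : ∀ y ∈ Y, y ^ m = 1) : IsReduced R := by
  refine isReduced_of_adjoin_eq_top (p := p) (X := ι ⁻¹' Y) ?_ hm fun x hx => hι ?_
  · refine Subalgebra.map_injective hι ?_
    rw [AlgHom.map_adjoin, Algebra.map_top, hY, Set.image_preimage_eq_of_subset]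
    intro y hy
    have : y ∈ ι.range := hY ▸ Algebra.subset_adjoin hy
    exact this
  · rw [map_pow, map_one]
    exact hYm _ hx

/-- Primes of an Artinian ring are maximal, and each residue field embeds in the algebraic closure;
an element killed by all characters is therefore in the nilradical. -/
theorem AlgHom.separates_points_of_isReduced {K R : Type*} [Field K] [CommRing R] [Algebra K R]
    [FiniteDimensional K R] [IsReduced R] {x : R}
    (hx : ∀ χ : R →ₐ[K] AlgebraicClosure K, χ x = 0) : x = 0 := by
  have : IsArtinianRing R := isArtinian_of_tower K inferInstance
  have hmem : x ∈ nilradical R := by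
    rw [nilradical_eq_sInf, Ideal.mem_sInf]
    intro I (hI : I.IsPrime)
    have hmax : I.IsMaximal := inferInstance
    let := Ideal.Quotient.field I
    let f : R ⧸ I →ₐ[K] AlgebraicClosure K := IsAlgClosed.lift
    have hf : Function.Injective f := RingHom.injective f.toRingHom
    refine Ideal.Quotient.eq_zero_iff_mem.1 (hf ?_)
    rw [map_zero]
    exact hx (f.comp (Ideal.Quotient.mkₐ K I))
  rwa [nilradical_eq_zero, Ideal.zero_eq_bot, Ideal.mem_bot] at hmem

/-- Dedekind's independence of characters. -/
theorem card_algHom_algebraicClosure_le (K R : Type*) [Field K] [CommRing R] [Algebra K R]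
    [FiniteDimensional K R] :
    Finite (R →ₐ[K] AlgebraicClosure K) ∧
      Nat.card (R →ₐ[K] AlgebraicClosure K) ≤ Module.finrank K R := by
  have h := (linearIndependent_algHom_toLinearMap K R (AlgebraicClosure K))
  have hfin : Finite (R →ₐ[K] AlgebraicClosure K) := h.finite
  refine ⟨hfin, ?_⟩
  have := Fintype.ofFinite (R →ₐ[K] AlgebraicClosure K)
  have h1 := h.fintype_card_le_finrank
  rwa [Module.finrank_linearMap_self, ← Nat.card_eq_fintype_card] at h1

/-- The linear representation over `ZMod p` afforded by an action on an elementary abelian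
`p`-group. -/
def linearOfMulAut {V Γ : Type*} [CommGroup V] [Group Γ] [Module (ZMod p) (Additive V)]
    (φ : Γ →* MulAut V) : Γ →* Module.End (ZMod p) (Additive V) where
  toFun g := (MonoidHom.toAdditive (φ g).toMonoidHom).toZModLinearMap p
  map_one' := by ext v; simp
  map_mul' g h := by ext v; simp

theorem linearOfMulAut_eq_iff {V Γ : Type*} [CommGroup V] [Group Γ] [Module (ZMod p) (Additive V)]
    (φ : Γ →* MulAut V) {g h : Γ} :
    linearOfMulAut (p := p) φ g = linearOfMulAut φ h ↔ φ g = φ h := by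
  constructor
  · intro H
    ext v
    exact congrArg Additive.toMul (LinearMap.congr_fun H (Additive.ofMul v))
  · intro H
    ext v
    exact congrArg Additive.ofMul (DFunLike.congr_fun H (Additive.toMul v))

/-- Conjugation by the image of a group element. -/
def conjAlgHom {K E Γ : Type*} [CommRing K] [Ring E] [Algebra K E] [Group Γ] (ψ : Γ →* E) (g : Γ) :
    E →ₐ[K] E where
  toFun y := ψ g * y * ψ g⁻¹
  map_one' := by simp [← map_mul]
  map_mul' x y := by
    have h : ψ g⁻¹ * ψ g = 1 := by simp [← map_mul]
    calc ψ g * (x * y) * ψ g⁻¹ = ψ g * x * (1 * y) * ψ g⁻¹ := by simp only [one_mul, mul_assoc]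
      _ = _ := by rw [← h]; simp only [mul_assoc]
  map_zero' := by simp
  map_add' := by simp [mul_add, add_mul]
  commutes' k := by
    rw [← Algebra.commutes, mul_assoc, ← map_mul, mul_inv_cancel, map_one, mul_one]

/-- Conjugation by `ψ g` restricts to an algebra endomorphism of `R`, so `Γ` permutes the characters
of `R`. If `g` fixes every character, then it fixes `R`, because the characters separate points.
Embedding the characters in `Fin n` makes the target independent of `R`. -/
theorem exists_hom_perm_of_embedding {K E R Γ : Type*} [Field K] [Ring E] [Algebra K E]
    [CommRing R] [Algebra K R] [FiniteDimensional K R] [IsReduced R] [Group Γ] (ψ : Γ →* E)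
    (ι : R →ₐ[K] E) (hι : Function.Injective ι)
    (hstab : ∀ g y, ∃ z, ι z = ψ g * ι y * ψ g⁻¹) {n : ℕ} (hn : Module.finrank K R ≤ n) :
    ∃ π : Γ →* Equiv.Perm (Fin n), ∀ g, π g = 1 → ∀ y, ψ g * ι y * ψ g⁻¹ = ι y := by
  choose cf hcf using hstab
  let c : Γ → (R →ₐ[K] R) := fun g =>
    { toFun := cf g
      map_one' := hι (by rw [hcf, map_one]; exact map_one (conjAlgHom (K := K) ψ g))
      map_mul' := fun x y => hι (by
        rw [map_mul, hcf, hcf, hcf, map_mul]; exact map_mul (conjAlgHom (K := K) ψ g) _ _)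
      map_zero' := hι (by rw [hcf, map_zero, mul_zero, zero_mul])
      map_add' := fun x y => hι (by rw [map_add, hcf, hcf, hcf, map_add, mul_add, add_mul])
      commutes' := fun k => hι (by
        rw [hcf, AlgHom.commutes]; exact (conjAlgHom (K := K) ψ g).commutes k) }
  have hc : ∀ g y, ι (c g y) = ψ g * ι y * ψ g⁻¹ := hcf
  let f : Γ →* Function.End (R →ₐ[K] AlgebraicClosure K) :=
    { toFun := fun g χ => χ.comp (c g⁻¹)
      map_one' := by
        funext χ
        refine AlgHom.ext fun y => congrArg χ (hι ?_)
        change ι (c 1⁻¹ y) = ι y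
        rw [hc]
        simp
      map_mul' := by
        intro g h
        funext χ
        refine AlgHom.ext fun y => congrArg χ (hι ?_)
        change ι (c (g * h)⁻¹ y) = ι (c h⁻¹ (c g⁻¹ y))
        rw [hc, hc, hc]
        simp [mul_assoc] }
  obtain ⟨hfin, hcard⟩ := card_algHom_algebraicClosure_le K R
  have := Fintype.ofFinite (R →ₐ[K] AlgebraicClosure K)
  obtain ⟨j⟩ : Nonempty ((R →ₐ[K] AlgebraicClosure K) ↪ Fin n) :=
    Function.Embedding.nonempty_of_card_le
      (by rw [← Nat.card_eq_fintype_card, Fintype.card_fin]; exact hcard.trans hn)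
  refine ⟨(Equiv.Perm.viaEmbeddingHom j).comp f.toHomPerm, fun g hg y => ?_⟩
  rw [MonoidHom.comp_apply, map_eq_one_iff _ (Equiv.Perm.viaEmbeddingHom_injective j),
    ← inv_eq_one, ← map_inv] at hg
  have hg' : ∀ χ : R →ₐ[K] AlgebraicClosure K, χ.comp (c g) = χ := by
    intro χ
    have h1 : χ.comp (c (g⁻¹)⁻¹) = χ := DFunLike.congr_fun hg χ
    rwa [inv_inv] at h1
  have h0 : c g y - y = 0 := by
    refine AlgHom.separates_points_of_isReduced (K := K) fun χ => ?_
    rw [map_sub, sub_eq_zero]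
    exact DFunLike.congr_fun (hg' χ) y
  rw [sub_eq_zero] at h0
  rw [← hc, h0]

theorem exists_hom_perm_of_algebra {E Γ : Type*} [Ring E] [Algebra (ZMod p) E]
    [FiniteDimensional (ZMod p) E] [Group Γ] (ψ : Γ →* E)
    {X : Set Γ} (hconj : ∀ g : Γ, ∀ x ∈ X, g * x * g⁻¹ ∈ X)
    (hcomm : ∀ x ∈ X, ∀ y ∈ X, ψ x * ψ y = ψ y * ψ x) {m : ℕ} (hm : p.Coprime m)
    (hX : ∀ x ∈ X, ψ x ^ m = 1) {n : ℕ} (hn : Module.finrank (ZMod p) E ≤ n) :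
    ∃ π : Γ →* Equiv.Perm (Fin n), ∀ g, π g = 1 → ∀ x ∈ X, ψ (g * x * g⁻¹) = ψ x := by
  let R := Algebra.adjoin (ZMod p) (ψ '' X)
  have hψc : ∀ a ∈ ψ '' X, ∀ b ∈ ψ '' X, a * b = b * a := by
    rintro _ ⟨x, hx, rfl⟩ _ ⟨y, hy, rfl⟩
    exact hcomm x hx y hy
  have hRc : IsMulCommutative R := Algebra.isMulCommutative_adjoin (ZMod p) hψc
  let i1 : CommRing R := { (inferInstance : Ring R) with mul_comm := hRc.is_comm.comm }
  let i2 : Algebra (ZMod p) R := inferInstance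
  have hred : IsReduced R := by
    refine isReduced_of_range_eq_adjoin (ι := R.val) Subtype.val_injective R.range_val hm ?_
    rintro _ ⟨x, hx, rfl⟩
    exact hX x hx
  have hstab : ∀ g (y : R), ∃ z : R, R.val z = ψ g * R.val y * ψ g⁻¹ := by
    intro g y
    have hle : R ≤ R.comap (conjAlgHom (K := ZMod p) ψ g) := by
      refine Algebra.adjoin_le ?_
      rintro _ ⟨x, hx, rfl⟩
      have h1 : conjAlgHom (K := ZMod p) ψ g (ψ x) = ψ (g * x * g⁻¹) := by simp [conjAlgHom]
      change conjAlgHom (K := ZMod p) ψ g (ψ x) ∈ R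
      rw [h1]
      exact Algebra.subset_adjoin ⟨_, hconj g x hx, rfl⟩
    exact ⟨⟨_, hle y.2⟩, rfl⟩
  have hfin : FiniteDimensional (ZMod p) R := inferInstance
  obtain ⟨π, hπ⟩ := exists_hom_perm_of_embedding ψ R.val Subtype.val_injective hstab
    ((Submodule.finrank_le (Subalgebra.toSubmodule R)).trans hn)
  refine ⟨π, fun g hg x hx => ?_⟩
  rw [map_mul, map_mul]
  exact hπ g hg ⟨ψ x, Algebra.subset_adjoin ⟨x, hx, rfl⟩⟩

theorem finrank_end_le {V : Type*} [CommGroup V] [Finite V] [Module (ZMod p) (Additive V)] {r : ℕ}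
    (hr : Nat.card V ≤ p ^ r) :
    Module.Finite (ZMod p) (Module.End (ZMod p) (Additive V)) ∧
      Module.finrank (ZMod p) (Module.End (ZMod p) (Additive V)) ≤ r ^ 2 := by
  have hV : Module.Finite (ZMod p) (Additive V) := Module.Finite.of_finite
  refine ⟨inferInstance, ?_⟩
  have hdim : Module.finrank (ZMod p) (Additive V) ≤ r := by
    have h1 : Nat.card (Additive V) = p ^ Module.finrank (ZMod p) (Additive V) := by
      rw [Module.natCard_eq_pow_finrank (K := ZMod p), Nat.card_zmod]
    exact (Nat.pow_le_pow_iff_right (Fact.out : p.Prime).one_lt).1 (h1 ▸ hr)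
  rw [Module.finrank_linearMap, sq]
  exact Nat.mul_le_mul hdim hdim

theorem exists_hom_perm_of_commute_of_module {V Γ : Type*} [CommGroup V] [Finite V]
    [Module (ZMod p) (Additive V)] {r : ℕ} (hr : Nat.card V ≤ p ^ r) [Group Γ] (φ : Γ →* MulAut V)
    {X : Set Γ} (hconj : ∀ g : Γ, ∀ x ∈ X, g * x * g⁻¹ ∈ X)
    (hcomm : ∀ x ∈ X, ∀ y ∈ X, φ x * φ y = φ y * φ x) {m : ℕ} (hm : p.Coprime m)
    (hX : ∀ x ∈ X, φ x ^ m = 1) :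
    ∃ π : Γ →* Equiv.Perm (Fin (r ^ 2)), ∀ g, π g = 1 → ∀ x ∈ X, φ (g * x * g⁻¹) = φ x := by
  obtain ⟨hfin, hn⟩ := finrank_end_le (p := p) hr
  have h1 : ∀ x ∈ X, ∀ y ∈ X, linearOfMulAut (p := p) φ x * linearOfMulAut φ y =
      linearOfMulAut φ y * linearOfMulAut φ x := by
    intro x hx y hy
    rw [← map_mul, ← map_mul]
    exact (linearOfMulAut_eq_iff φ).2 (by rw [map_mul, map_mul, hcomm x hx y hy])
  have h2 : ∀ x ∈ X, linearOfMulAut (p := p) φ x ^ m = 1 := by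
    intro x hx
    rw [← map_pow, ← map_one (linearOfMulAut (p := p) φ)]
    exact (linearOfMulAut_eq_iff φ).2 (by rw [map_pow, hX x hx, map_one])
  obtain ⟨π, hπ⟩ := exists_hom_perm_of_algebra (linearOfMulAut (p := p) φ) hconj h1 hm h2 hn
  exact ⟨π, fun g hg x hx => (linearOfMulAut_eq_iff φ).1 (hπ g hg x hx)⟩

/-- A group acting on a set of commuting automorphisms of an elementary abelian group of order at
most `p ^ r`, all of order prime to `p`, permutes at most `r ^ 2` eigencharacters, and these
determine the automorphisms. -/
theorem exists_hom_perm_of_commute {V Γ : Type*} [CommGroup V] [Finite V]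
    (hV : ∀ v : V, v ^ p = 1) {r : ℕ} (hr : Nat.card V ≤ p ^ r) [Group Γ] (φ : Γ →* MulAut V)
    {X : Set Γ} (hconj : ∀ g : Γ, ∀ x ∈ X, g * x * g⁻¹ ∈ X)
    (hcomm : ∀ x ∈ X, ∀ y ∈ X, φ x * φ y = φ y * φ x) {m : ℕ} (hm : p.Coprime m)
    (hX : ∀ x ∈ X, φ x ^ m = 1) :
    ∃ π : Γ →* Equiv.Perm (Fin (r ^ 2)), ∀ g, π g = 1 → ∀ x ∈ X, φ (g * x * g⁻¹) = φ x := by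
  have hV' : ∀ v : Additive V, p • v = 0 := fun v => hV v.toMul
  exact @exists_hom_perm_of_commute_of_module p _ V Γ _ _ (AddCommGroup.zmodModule hV') r hr _ φ X hconj
    hcomm m hm hX

end Semisimple

/-! ### Irreducible actions on finite abelian groups. -/

/-- The subgroup `L` is invariant under the action `φ`. -/
def IsInvariantUnder {B V : Type*} [Group B] [Group V] (φ : B →* MulAut V) (L : Subgroup V) :
    Prop :=
  ∀ g, ∀ v ∈ L, φ g v ∈ L

section Action

variable {B V : Type*} [Group B] [CommGroup V]

/-- The only invariant subgroups are the trivial ones. -/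
structure IsIrreducibleAction (φ : B →* MulAut V) : Prop where
  nontrivial : Nontrivial V
  eq_bot_or_eq_top : ∀ L : Subgroup V, IsInvariantUnder φ L → L = ⊥ ∨ L = ⊤

theorem IsIrreducibleAction.exists_prime [Finite V] {φ : B →* MulAut V}
    (h : IsIrreducibleAction φ) : ∃ p : ℕ, p.Prime ∧ ∀ v : V, v ^ p = 1 := by
  have := h.nontrivial
  obtain ⟨p, hp, hpd⟩ := Nat.exists_prime_and_dvd (Finite.one_lt_card (α := V)).ne'
  have : Fact p.Prime := ⟨hp⟩
  refine ⟨p, hp, ?_⟩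
  obtain ⟨v, hv⟩ := exists_prime_orderOf_dvd_card' p hpd
  have hinv : IsInvariantUnder φ (powMonoidHom p : V →* V).ker := by
    intro g w hw
    rw [MonoidHom.mem_ker, powMonoidHom_apply] at *
    rw [← map_pow, hw, map_one]
  rcases h.eq_bot_or_eq_top _ hinv with hb | ht
  · have h1 : v ∈ (powMonoidHom p : V →* V).ker := by
      rw [MonoidHom.mem_ker, powMonoidHom_apply, ← hv, pow_orderOf_eq_one]
    rw [hb, mem_bot] at h1
    rw [h1, orderOf_one] at hv
    exact absurd hv.symm hp.ne_one
  · intro w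
    have h1 : w ∈ (powMonoidHom p : V →* V).ker := ht ▸ mem_top w
    rwa [MonoidHom.mem_ker, powMonoidHom_apply] at h1

/-- A `p`-group acting on a nontrivial `p`-group has a nontrivial fixed point, and the fixed points
of a normal subgroup form an invariant subgroup. -/
theorem IsIrreducibleAction.eq_one_of_isPGroup [Finite V] {φ : B →* MulAut V}
    (h : IsIrreducibleAction φ) {p : ℕ} [Fact p.Prime] (hV : ∀ v : V, v ^ p = 1)
    {P : Subgroup B} [hPn : P.Normal] (hP : IsPGroup p P) : ∀ x ∈ P, φ x = 1 := by
  have := h.nontrivial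
  let : MulAction P V :=
    { smul := fun x v => φ x v
      one_smul := fun v => by change φ ((1 : P) : B) v = v; simp
      mul_smul := fun x y v => by change φ ((x * y : P) : B) v = φ x (φ y v); simp }
  have hs : ∀ (x : P) (v : V), x • v = φ x v := fun _ _ => rfl
  have hVp : IsPGroup p V := fun v => ⟨1, by rw [pow_one, hV]⟩
  obtain ⟨n, hn0, hn⟩ := hVp.nontrivial_iff_card.1 inferInstance
  have hd : p ∣ Nat.card V := hn ▸ dvd_pow_self p hn0.ne'
  obtain ⟨b, hb, hb1⟩ := hP.exists_fixed_point_of_prime_dvd_card_of_fixed_point V hd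
    (a := (1 : V)) (fun x => by rw [hs, map_one])
  let L : Subgroup V :=
    { carrier := {v | ∀ x ∈ P, φ x v = v}
      one_mem' := fun x _ => map_one _
      mul_mem' := fun ha hb x hx => by rw [map_mul, ha x hx, hb x hx]
      inv_mem' := fun ha x hx => by rw [map_inv, ha x hx] }
  have hL : IsInvariantUnder φ L := by
    intro g v hv x hx
    have h1 := hv (g⁻¹ * x * g) (by simpa using hPn.conj_mem x hx g⁻¹)
    have h2 : φ x (φ g v) = φ g (φ (g⁻¹ * x * g) v) := by
      rw [← MulAut.mul_apply, ← MulAut.mul_apply, ← map_mul, ← map_mul]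
      congr 2
      group
    rw [h2, h1]
  rcases h.eq_bot_or_eq_top L hL with h0 | h0
  · have : b ∈ L := fun x hx => hb ⟨x, hx⟩
    rw [h0, mem_bot] at this
    exact absurd this.symm hb1
  · intro x hx
    ext v
    have : v ∈ L := h0 ▸ mem_top v
    exact this x hx

/-- The Sylow `p`-subgroup of `N` is characteristic in `N`, so it is normal in `B` and acts
trivially; its index in `N` serves as `m`. -/
theorem IsIrreducibleAction.exists_pow_eq_one [Finite B] [Finite V] {φ : B →* MulAut V}
    (h : IsIrreducibleAction φ) {p : ℕ} (hp : p.Prime) (hV : ∀ v : V, v ^ p = 1)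
    (N : Subgroup B) [N.Normal] [Group.IsNilpotent N] :
    ∃ m, p.Coprime m ∧ ∀ x ∈ N, φ x ^ m = 1 := by
  have : Fact p.Prime := ⟨hp⟩
  obtain ⟨P⟩ : Nonempty (Sylow p N) := inferInstance
  have hPn : (P : Subgroup N).Normal := (Group.isNilpotent_of_finite_tfae.out 0 3 rfl rfl).1 ‹_› p ‹_› P
  have hPc : (P : Subgroup N).Characteristic := P.characteristic_of_normal hPn
  have hn : ((P : Subgroup N).map N.subtype).Normal := inferInstance
  refine ⟨(P : Subgroup N).index, (Nat.Prime.coprime_iff_not_dvd hp).2 P.not_dvd_index, ?_⟩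
  intro x hx
  rw [← map_pow]
  refine h.eq_one_of_isPGroup hV (P.2.map N.subtype) _ ?_
  exact ⟨(⟨x, hx⟩ : N) ^ (P : Subgroup N).index, pow_index_mem _ _, rfl⟩

end Action

/-! ### Index of a maximal abelian normal subgroup. -/

/-- A jointly faithful family of irreducible actions on abelian groups of rank at most `r`. -/
structure IsFaithfulIrreducibleFamily {B ι : Type*} [Group B] {V : ι → Type*}
    [∀ i, CommGroup (V i)] (φ : ∀ i, B →* MulAut (V i)) (r : ℕ) : Prop where
  finite : ∀ i, Finite (V i)
  irreducible : ∀ i, IsIrreducibleAction (φ i)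
  rank : ∀ i, HasRankLE (V i) r
  faithful : ∀ g, (∀ i, φ i g = 1) → g = 1

theorem isNilpotent_of_commutator_le {G : Type*} [Group G] {A N : Subgroup G} (h : ⁅N, N⁆ ≤ A)
    (hA : A ≤ centralizer N) : Group.IsNilpotent N := by
  refine isNilpotent_of_lowerCentralSeries_eq_bot (n := 2) ?_
  change ⁅⁅N, N⁆, N⁆ = ⊥
  rw [commutator_eq_bot_iff_le_centralizer]
  exact h.trans hA

theorem index_le_card_of_forall {G X : Type*} [Group G] [Finite X] {K : Subgroup G} (f : G → X)
    (hf : ∀ g h, f g = f h → g⁻¹ * h ∈ K) : K.index ≤ Nat.card X := by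
  refine Nat.card_le_card_of_injective (fun q : G ⧸ K => f q.out) fun a b hab => ?_
  rw [← QuotientGroup.out_eq' a, ← QuotientGroup.out_eq' b]
  exact QuotientGroup.eq.2 (hf _ _ hab)

theorem card_le_mul_card_of_fiber_le {X Y : Type*} [Finite X] [Finite Y] (f : X → Y) {n : ℕ}
    (hf : ∀ x, Nat.card {y // f y = f x} ≤ n) : Nat.card X ≤ n * Nat.card Y := by
  classical
  have := Fintype.ofFinite X
  have := Fintype.ofFinite Y
  rw [Nat.card_eq_fintype_card, Nat.card_eq_fintype_card]
  refine (Finset.card_le_mul_card_image (f := f) Finset.univ n ?_).trans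
    (Nat.mul_le_mul_left n (Finset.card_le_univ _))
  intro a ha
  obtain ⟨x, -, rfl⟩ := Finset.mem_image.1 ha
  have := hf x
  rwa [Nat.card_eq_fintype_card, Fintype.card_subtype] at this

namespace HasRankLE

variable {B : Type*} [Group B] [Finite B] {r : ℕ}

theorem card_torsion_le (h : HasRankLE B r) {A : Subgroup B} (hA : A ≤ centralizer A) {e : ℕ}
    (he : 0 < e) : Nat.card {a : A // a ^ e = 1} ≤ e ^ r := by
  have hc : ∀ x y : A, x * y = y * x := fun x y => Subtype.ext (hA y.2 x x.2)
  let T : Subgroup A :=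
    { carrier := {a | a ^ e = 1}
      one_mem' := one_pow e
      mul_mem' := fun {a b} (ha : a ^ e = 1) (hb : b ^ e = 1) => by
        change (a * b) ^ e = 1
        rw [(show Commute a b from hc a b).mul_pow, ha, hb, one_mul]
      inv_mem' := fun {a} (ha : a ^ e = 1) => by
        change a⁻¹ ^ e = 1
        rw [inv_pow, ha, inv_one] }
  exact ((h.subgroup A).subgroup T).card_le_of_comm (fun x y => Subtype.ext (hc x y)) he
    fun x => Subtype.ext x.2

/-- A bound for the number of conjugates of `t` under a group `C` that fixes `t ^ e`. -/
theorem relIndex_centralizer_le (h : HasRankLE B r) {A N C : Subgroup B} {e k : ℕ} (he : 0 < e)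
    (hAN : A ≤ N) (hA : A ≤ centralizer N) (hk : A.relIndex N ≤ k) {t : B}
    (hC : ∀ g ∈ C, g * t * g⁻¹ ∈ N ∧ (g * t * g⁻¹) ^ e = t ^ e) :
    (centralizer {t}).relIndex C ≤ e ^ r * k := by
  let Y := {y : N // (y : B) ^ e = t ^ e}
  have h1 : (centralizer {t}).relIndex C ≤ Nat.card Y := by
    refine index_le_card_of_forall
      (fun g : C => (⟨⟨g * t * g⁻¹, (hC g g.2).1⟩, (hC g g.2).2⟩ : Y)) fun g g' hg => ?_
    rw [mem_subgroupOf, mem_centralizer_singleton_iff]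
    have h2 : (g : B) * t * (g : B)⁻¹ = g' * t * (g' : B)⁻¹ :=
      congrArg (fun y : Y => ((y : N) : B)) hg
    have h3 : t = (g : B)⁻¹ * (g' * t * (g' : B)⁻¹) * g := by rw [← h2]; group
    rw [coe_mul, coe_inv]
    nth_rewrite 2 [h3]
    group
  -- The conjugates of `t` lie in at most `k` cosets of `A`. Two of them in the same coset have
  -- equal `e`-th powers and differ by an element of `A`, which commutes with them and so is
  -- `e`-torsion.
  refine h1.trans ((card_le_mul_card_of_fiber_le
    (fun y : Y => (QuotientGroup.mk (y : N) : N ⧸ A.subgroupOf N)) (n := e ^ r) ?_).trans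
    (Nat.mul_le_mul_left _ hk))
  intro x
  refine le_trans ?_ (h.card_torsion_le (A := A) (hA.trans (centralizer_le hAN)) he)
  have hmem : ∀ y : {y : Y // (QuotientGroup.mk (y : N) : N ⧸ A.subgroupOf N) =
      QuotientGroup.mk (x : N)}, ((x : N) : B)⁻¹ * ((y : Y) : N) ∈ A := by
    intro y
    have := QuotientGroup.eq.1 y.2.symm
    rwa [mem_subgroupOf] at this
  refine Nat.card_le_card_of_injective (fun y => ⟨⟨_, hmem y⟩, ?_⟩) ?_
  · refine Subtype.ext ?_
    rw [coe_pow, coe_one]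
    have hcm : Commute (((x : N) : B)) (((x : N) : B)⁻¹ * ((y : Y) : N)) :=
      hA (hmem y) _ (x : N).2
    have h2 := hcm.mul_pow e
    rw [mul_inv_cancel_left, (y : Y).2, x.2] at h2
    exact (mul_eq_left.1 h2.symm)
  · intro y y' hy
    have h2 := congrArg (fun z : {a : A // a ^ e = 1} => ((z : A) : B)) hy
    exact Subtype.ext (Subtype.ext (Subtype.ext (mul_left_cancel h2)))

/-- The centralizer of `N` is the intersection of the centralizers of at most `r` generators. -/
theorem relIndex_centralizer_le_pow (h : HasRankLE B r) {N C : Subgroup B} {k : ℕ} (hk0 : 0 < k)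
    (hk : ∀ t ∈ N, (centralizer {t}).relIndex C ≤ k) :
    (centralizer (N : Set B)).relIndex C ≤ k ^ r := by
  classical
  obtain ⟨S, hS, rfl⟩ := h N
  have h1 : (⨅ t : S, centralizer {(t : B)}) ≤ centralizer (closure (S : Set B) : Set B) := by
    intro g hg
    rw [centralizer_closure, mem_centralizer_iff]
    intro t ht
    exact mem_centralizer_iff.1 ((mem_iInf.1 hg) ⟨t, ht⟩) t rfl
  calc (centralizer (closure (S : Set B) : Set B)).relIndex C
      ≤ (⨅ t : S, centralizer {(t : B)}).relIndex C := 
        relIndex_le_of_le_left h1 index_ne_zero_of_finite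
    _ ≤ ∏ t : S, (centralizer {(t : B)}).relIndex C := relIndex_iInf_le _
    _ ≤ ∏ _t : S, k := Finset.prod_le_prod' fun t _ => hk t (subset_closure t.2)
    _ ≤ k ^ r := by simpa using Nat.pow_le_pow_right hk0 hS

end HasRankLE

namespace IsFaithfulIrreducibleFamily

variable {B ι Γ : Type*} [Group B] [Finite B] {V : ι → Type*} [∀ i, CommGroup (V i)]
  {φ : ∀ i, B →* MulAut (V i)} {r : ℕ} [Group Γ]

theorem exists_perm_family (h : IsFaithfulIrreducibleFamily φ r) (N : Subgroup B) [N.Normal]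
    [Group.IsNilpotent N] (j : Γ →* B) {X : Set Γ} (hconj : ∀ g : Γ, ∀ x ∈ X, g * x * g⁻¹ ∈ X)
    (hcomm : ∀ x ∈ X, ∀ y ∈ X, j x * j y = j y * j x) (hXN : ∀ x ∈ X, j x ∈ N) :
    ∃ π : ι → Γ →* Equiv.Perm (Fin (r ^ 2)),
      ∀ g, (∀ i, π i g = 1) → ∀ x ∈ X, j (g * x * g⁻¹) = j x := by
  have key : ∀ i, ∃ π : Γ →* Equiv.Perm (Fin (r ^ 2)),
      ∀ g, π g = 1 → ∀ x ∈ X, φ i (j (g * x * g⁻¹)) = φ i (j x) := by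
    intro i
    have := h.finite i
    obtain ⟨p, hp, hV⟩ := (h.irreducible i).exists_prime
    have : Fact p.Prime := ⟨hp⟩
    obtain ⟨m, hm, hmN⟩ := (h.irreducible i).exists_pow_eq_one hp hV N
    exact exists_hom_perm_of_commute hV ((h.rank i).card_le_of_comm mul_comm hp.pos hV)
      ((φ i).comp j) hconj
      (fun x hx y hy => by
        simp only [MonoidHom.comp_apply]
        rw [← map_mul, hcomm x hx y hy, map_mul])
      hm (fun x hx => hmN _ (hXN x hx))
  choose π hπ using key
  refine ⟨π, fun g hg x hx => ?_⟩
  rw [← mul_inv_eq_one]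
  refine h.faithful _ fun i => ?_
  rw [map_mul, map_inv, hπ i g (hg i) x hx, mul_inv_cancel]

/-- The exponent `(r ^ 2)!` is the order of `Sym(r ^ 2)`, so it kills the image of `g` in all the
permutation actions at once. -/
theorem pow_factorial_commute (h : IsFaithfulIrreducibleFamily φ r) (N : Subgroup B) [N.Normal]
    [Group.IsNilpotent N] (j : Γ →* B) {X : Set Γ} (hconj : ∀ g : Γ, ∀ x ∈ X, g * x * g⁻¹ ∈ X)
    (hcomm : ∀ x ∈ X, ∀ y ∈ X, j x * j y = j y * j x) (hXN : ∀ x ∈ X, j x ∈ N) (g : Γ) {x : Γ}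
    (hx : x ∈ X) : j g ^ (r ^ 2).factorial * j x = j x * j g ^ (r ^ 2).factorial := by
  obtain ⟨π, hπ⟩ := h.exists_perm_family N j hconj hcomm hXN
  have h1 := hπ (g ^ (r ^ 2).factorial) (fun i => by
    have : Nat.card (Equiv.Perm (Fin (r ^ 2))) = (r ^ 2).factorial := by
      rw [Nat.card_perm, Nat.card_fin]
    rw [map_pow, ← this, pow_card_eq_one']) x hx
  rw [map_mul, map_mul, map_inv, map_pow, mul_inv_eq_iff_eq_mul] at h1
  exact h1

/-- The centralizer of an abelian normal subgroup has bounded index. -/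
theorem index_centralizer_le [Group.IsSolvable B] (h : IsFaithfulIrreducibleFamily φ r)
    (hr : HasRankLE B r) (A : Subgroup B) [A.Normal] (hA : A ≤ centralizer A) :
    (centralizer (A : Set B)).index ≤
      ((r ^ 2).factorial ^ r) ^ (r ^ 2).factorial := by
  have hnil : Group.IsNilpotent A :=
    isNilpotent_of_commutator_le (commutator_le_left A A) hA
  have hconj : ∀ g : B, ∀ x ∈ (A : Set B), g * x * g⁻¹ ∈ (A : Set B) :=
    fun g x hx => Normal.conj_mem ‹_› x hx g
  have hcomm : ∀ x ∈ (A : Set B), ∀ y ∈ (A : Set B),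
      MonoidHom.id B x * MonoidHom.id B y = MonoidHom.id B y * MonoidHom.id B x :=
    fun x hx y hy => hA hy x hx
  have hpow := h.pow_factorial_commute A (MonoidHom.id B) hconj hcomm (fun _ => id)
  obtain ⟨π, hπ⟩ := h.exists_perm_family A (MonoidHom.id B) hconj hcomm (fun _ => id)
  -- A soluble subgroup of `Sym(r ^ 2)` has derived length at most its order, so this term dies in
  -- every permutation action simultaneously.
  have hder : derivedSeries B (r ^ 2).factorial ≤ centralizer A := by
    intro g hg a ha
    have h1 := hπ g (fun i => derivedSeries_le_ker (π i)
      (by rw [Nat.card_perm, Nat.card_fin]) hg) a ha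
    exact (mul_inv_eq_iff_eq_mul.1 h1).symm
  refine (hr.quotient (centralizer (A : Set B))).card_le_of_derivedSeries (Nat.factorial_pos _)
    ?_ ?_
  · intro x
    induction x using QuotientGroup.induction_on with | H x =>
    rw [← QuotientGroup.mk_pow, QuotientGroup.eq_one_iff]
    exact fun a ha => (hpow x ha).symm
  · rw [← map_derivedSeries_eq (QuotientGroup.mk'_surjective (centralizer (A : Set B))),
      eq_bot_iff, map_le_iff_le_comap]
    intro g hg
    rw [mem_comap, mem_bot, QuotientGroup.mk'_apply, QuotientGroup.eq_one_iff]
    exact hder hg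

/-- A normal subgroup that is abelian modulo a central subgroup `A` has exponent dividing
`(r ^ 2)!` modulo its centre. -/
theorem pow_factorial_mem_centralizer (h : IsFaithfulIrreducibleFamily φ r)
    {A N : Subgroup B} [N.Normal] (hNA : ⁅N, N⁆ ≤ A) (hA : A ≤ centralizer N) {y : B}
    (hy : y ∈ N) : y ^ (r ^ 2).factorial ∈ centralizer (N : Set B) := by
  have hnil : Group.IsNilpotent N := isNilpotent_of_commutator_le hNA hA
  intro x hx
  -- The set `X` is the coset `A x`: it is closed under conjugation by `N` because `[N, N] ≤ A`, and
  -- its elements commute because `A` is central in `N`.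
  refine (h.pow_factorial_commute N N.subtype (X := {z | (z : B) * x⁻¹ ∈ A}) ?_ ?_
    (fun z _ => z.2) ⟨y, hy⟩ (x := ⟨x, hx⟩) (by simp)).symm
  · intro g z (hz : (z : B) * x⁻¹ ∈ A)
    have h1 := hNA (commutator_mem_commutator g.2 z.2)
    have h2 := A.mul_mem h1 hz
    rw [commutatorElement_def] at h2
    change ((g : B) * z * (g : B)⁻¹) * x⁻¹ ∈ A
    convert h2 using 1
    group
  · intro z (hz : (z : B) * x⁻¹ ∈ A) w (hw : (w : B) * x⁻¹ ∈ A)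
    have h1 : Commute ((w : B) * x⁻¹) z := (hA hw z z.2).symm
    have h2 : Commute x (z : B) := by
      have : Commute x ((z : B) * x⁻¹) := hA hz x hx
      have := this.mul_right (Commute.refl x)
      rwa [inv_mul_cancel_right] at this
    have := h1.mul_left h2
    rw [inv_mul_cancel_right] at this
    exact this.symm

/-- The index of a maximal abelian normal subgroup is bounded. -/
theorem index_le [Group.IsSolvable B] (h : IsFaithfulIrreducibleFamily φ r)
    (hr : HasRankLE B r) {A : Subgroup B} [hAn : A.Normal] (hA : A ≤ centralizer A)
    (hmax : ∀ A' : Subgroup B, A'.Normal → A' ≤ centralizer A' → A ≤ A' → A' = A) :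
    A.index ≤ ((r ^ 2).factorial ^ r * (r ^ 2).factorial ^ r) ^ r *
      ((r ^ 2).factorial ^ r) ^ (r ^ 2).factorial := by
  have he : 0 < (r ^ 2).factorial := Nat.factorial_pos _
  set C := centralizer (A : Set B) with hC
  obtain ⟨N, hN⟩ := (Set.toFinite {N : Subgroup B | N.Normal ∧ A ≤ N ∧ N ≤ C ∧ ⁅N, N⁆ ≤ A}).exists_maximal
    ⟨A, hAn, le_rfl, hA, commutator_le_left A A⟩
  obtain ⟨⟨hNn, hAN, hNC, hNA⟩, hNmax⟩ := hN
  have hAcN : A ≤ centralizer N := le_centralizer_iff.1 hNC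
  have hZ : ∀ y ∈ N, y ∈ centralizer (N : Set B) → y ∈ A := by
    have : N ⊓ centralizer (N : Set B) = A := by
      refine hmax _ inferInstance ?_ (le_inf hAN hAcN)
      exact inf_le_right.trans (centralizer_le inf_le_left)
    intro y hy hy'
    exact this ▸ ⟨hy, hy'⟩
  have hpow : ∀ y ∈ N, y ^ (r ^ 2).factorial ∈ A := fun y hy =>
    hZ _ (pow_mem hy _) (h.pow_factorial_mem_centralizer hNA hAcN hy)
  have hNrel : A.relIndex N ≤ (r ^ 2).factorial ^ r := hr.relIndex_le hNA he hpow
  -- Otherwise some normal `M ≤ C(N)` outside `A` is abelian modulo `A`. Then `M N` still satisfies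
  -- the conditions on `N`, so `M ≤ N ∩ C(N) = A`.
  have hle : centralizer (N : Set B) ≤ A := by
    by_contra hcon
    obtain ⟨M, hMn, hMD, hMA, hMM⟩ := exists_normal_commutator_le hcon
    refine hMA ?_
    have h1 : M ⊔ N ≤ N := by
      refine hNmax ⟨inferInstance, hAN.trans le_sup_right, sup_le (hMD.trans ?_) hNC, ?_⟩ le_sup_right
      · exact centralizer_le hAN
      · have h2 : ⁅M, N⁆ = ⊥ := commutator_eq_bot_iff_le_centralizer.2 hMD
        have h3 : ∀ K : Subgroup B, ⁅M, K⁆ ≤ A → ⁅N, K⁆ ≤ A → ⁅M ⊔ N, K⁆ ≤ A :=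
          fun K => commutator_sup_le
        refine h3 _ ?_ ?_ <;> rw [commutator_comm]
        · exact h3 _ hMM (by rw [commutator_comm, h2]; exact bot_le)
        · exact h3 _ (h2 ▸ bot_le) hNA
    intro x hx
    exact hZ x (h1 (le_sup_left (a := M) hx)) (hMD hx)
  calc A.index ≤ (centralizer (N : Set B)).index :=
        Nat.le_of_dvd (Nat.pos_of_ne_zero index_ne_zero_of_finite) (index_dvd_of_le hle)
    _ = (centralizer (N : Set B)).relIndex C * C.index :=
        (relIndex_mul_index (centralizer_le hAN)).symm
    _ ≤ _ := by
      refine Nat.mul_le_mul (hr.relIndex_centralizer_le_pow (by positivity) fun t ht => ?_)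
        (h.index_centralizer_le hr A hA)
      refine hr.relIndex_centralizer_le he hAN hAcN hNrel fun g hg => ⟨hNn.conj_mem t ht g, ?_⟩
      rw [conj_pow, hg _ (hpow t ht) |>.symm, mul_inv_cancel_right]

end IsFaithfulIrreducibleFamily

/-! ### Maximal invariant subgroups and Clifford's theorem. -/

section QuotientAction

variable {B W : Type*} [Group B] [Group W] {φ : B →* MulAut W} {L : Subgroup W}

theorem IsInvariantUnder.map_eq (hL : IsInvariantUnder φ L) (g : B) :
    L.map (φ g : W →* W) = L := by
  refine le_antisymm ?_ fun v hv => ⟨φ g⁻¹ v, hL g⁻¹ v hv, ?_⟩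
  · rintro _ ⟨v, hv, rfl⟩
    exact hL g v hv
  · change φ g (φ g⁻¹ v) = v
    simp

/-- The action induced on the quotient by an invariant normal subgroup. -/
def quotientAction (φ : B →* MulAut W) (L : Subgroup W) [L.Normal] (hL : IsInvariantUnder φ L) :
    B →* MulAut (W ⧸ L) where
  toFun g := QuotientGroup.congr L L (φ g) (hL.map_eq g)
  map_one' := by
    ext w
    induction w using QuotientGroup.induction_on
    simp
  map_mul' g h := by
    ext w
    induction w using QuotientGroup.induction_on
    simp

theorem quotientAction_mk [L.Normal] (hL : IsInvariantUnder φ L) (g : B) (w : W) :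
    quotientAction φ L hL g (w : W ⧸ L) = (φ g w : W) := rfl

theorem quotientAction_eq_one_iff [L.Normal] (hL : IsInvariantUnder φ L) {g : B} :
    quotientAction φ L hL g = 1 ↔ ∀ w, (φ g w)⁻¹ * w ∈ L := by
  constructor
  · intro h w
    have := DFunLike.congr_fun h (w : W ⧸ L)
    rw [quotientAction_mk] at this
    exact QuotientGroup.eq.1 this
  · intro h
    ext w
    induction w using QuotientGroup.induction_on with | H w =>
    rw [quotientAction_mk]
    exact QuotientGroup.eq.2 (h w)

end QuotientAction

/-- A maximal proper invariant subgroup. -/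
structure IsMaxInvariant {B W : Type*} [Group B] [Group W] (φ : B →* MulAut W)
    (L : Subgroup W) : Prop where
  invariant : IsInvariantUnder φ L
  ne_top : L ≠ ⊤
  eq_or_eq_top : ∀ L' : Subgroup W, IsInvariantUnder φ L' → L ≤ L' → L' = L ∨ L' = ⊤

section MaxInvariant

variable {B W : Type*} [Group B] [CommGroup W] {φ : B →* MulAut W}

theorem IsMaxInvariant.isIrreducibleAction {L : Subgroup W} (h : IsMaxInvariant φ L) :
    IsIrreducibleAction (quotientAction φ L h.invariant) := by
  refine ⟨QuotientGroup.nontrivial_iff.2 h.ne_top, fun L' hL' => ?_⟩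
  have h1 : IsInvariantUnder φ (L'.comap (QuotientGroup.mk' L)) := fun g w hw =>
    hL' g (w : W ⧸ L) hw
  have h2 : L ≤ L'.comap (QuotientGroup.mk' L) := by
    intro w hw
    rw [mem_comap, QuotientGroup.mk'_apply, (QuotientGroup.eq_one_iff w).2 hw]
    exact one_mem _
  have h3 := map_comap_eq_self_of_surjective (QuotientGroup.mk'_surjective L) L'
  rcases h.eq_or_eq_top _ h1 h2 with h0 | h0
  · left
    rw [← h3, h0, QuotientGroup.map_mk'_self]
  · right
    rw [← h3, h0, map_top_of_surjective _ (QuotientGroup.mk'_surjective L)]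

theorem isFaithfulIrreducibleFamily_of_maxInvariant [Finite W] (hφ : Function.Injective φ) {r : ℕ}
    (hr : HasRankLE W r) (hW : ∀ w, (∀ L, IsMaxInvariant φ L → w ∈ L) → w = 1) :
    IsFaithfulIrreducibleFamily
      (fun i : {L : Subgroup W // IsMaxInvariant φ L} => quotientAction φ i.1 i.2.invariant) r where
  finite _ := inferInstance
  irreducible i := i.2.isIrreducibleAction
  rank i := hr.quotient i.1
  faithful g hg := by
    rw [← map_eq_one_iff φ hφ]
    ext w
    have := hW ((φ g w)⁻¹ * w) fun L hL =>
      (quotientAction_eq_one_iff hL.invariant).1 (hg ⟨L, hL⟩) w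
    exact inv_mul_eq_one.1 this

theorem exists_le_isMaxInvariant [Finite W] {L : Subgroup W} (hL : IsInvariantUnder φ L)
    (hne : L ≠ ⊤) : ∃ M, L ≤ M ∧ IsMaxInvariant φ M := by
  obtain ⟨M, hLM, hM⟩ :=
    (Set.toFinite {M : Subgroup W | IsInvariantUnder φ M ∧ M ≠ ⊤}).exists_le_maximal ⟨hL, hne⟩
  refine ⟨M, hLM, hM.prop.1, hM.prop.2, fun L' hL' hle => ?_⟩
  by_cases ht : L' = ⊤
  · exact Or.inr ht
  · exact Or.inl (le_antisymm (hM.le_of_ge ⟨hL', ht⟩ hle) hle)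

theorem IsInvariantUnder.comap_of_normal {A : Subgroup B} [hA : A.Normal] {L : Subgroup W}
    (hL : IsInvariantUnder (φ.comp A.subtype) L) (g : B) :
    IsInvariantUnder (φ.comp A.subtype) (L.comap (φ g : W →* W)) := by
  intro a v hv
  have h1 := hL ⟨g * a * g⁻¹, hA.conj_mem a a.2 g⟩ (φ g v) hv
  have h2 : φ (g * a * g⁻¹) (φ g v) = φ g (φ a v) := by
    rw [← MulAut.mul_apply, ← MulAut.mul_apply, ← map_mul, ← map_mul]
    congr 2
    group
  change φ g (φ a v) ∈ L
  rw [← h2]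
  exact h1

theorem IsMaxInvariant.comap_of_normal {A : Subgroup B} [hA : A.Normal] {L : Subgroup W}
    (hL : IsMaxInvariant (φ.comp A.subtype) L) (g : B) :
    IsMaxInvariant (φ.comp A.subtype) (L.comap (φ g : W →* W)) := by
  have hcc : ∀ (x : B) (K : Subgroup W), (K.comap (φ x⁻¹ : W →* W)).comap (φ x : W →* W) = K := by
    intro x K
    ext v
    change φ x⁻¹ (φ x v) ∈ K ↔ _
    simp
  refine ⟨hL.invariant.comap_of_normal g, ?_, fun L' hL' hle => ?_⟩
  · intro ht
    refine hL.ne_top (eq_top_iff.2 fun v _ => ?_)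
    have : φ g⁻¹ v ∈ L.comap (φ g : W →* W) := ht ▸ mem_top _
    change φ g (φ g⁻¹ v) ∈ L at this
    simpa using this
  · have hle' : L ≤ L'.comap (φ g⁻¹ : W →* W) := by
      have := comap_mono (f := (φ g⁻¹ : W →* W)) hle
      have h2 := hcc g⁻¹ L
      rw [inv_inv] at h2
      rwa [h2] at this
    rcases hL.eq_or_eq_top _ (hL'.comap_of_normal g⁻¹) hle' with h0 | h0
    · left
      rw [← h0, hcc]
    · right
      rw [← hcc g L', h0, comap_top]

/-- Clifford's theorem: if the maximal invariant subgroups of `B` intersect trivially, then so do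
those of a normal subgroup. -/
theorem eq_one_of_forall_maxInvariant_normal [Finite W] (A : Subgroup B) [A.Normal]
    (hW : ∀ w, (∀ L, IsMaxInvariant φ L → w ∈ L) → w = 1) (w : W)
    (hw : ∀ L, IsMaxInvariant (φ.comp A.subtype) L → w ∈ L) : w = 1 := by
  refine hW w fun L hL => ?_
  have hLA : IsInvariantUnder (φ.comp A.subtype) L := fun a v hv => hL.invariant a v hv
  -- `B` permutes the `A`-maximal subgroups above `L`, so `J` is `B`-invariant. It is proper because
  -- at least one such subgroup exists, hence `J = L`.
  let J := sInf {M : Subgroup W | IsMaxInvariant (φ.comp A.subtype) M ∧ L ≤ M}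
  have hJ : IsInvariantUnder φ J := by
    intro g v hv
    rw [mem_sInf] at *
    rintro M ⟨hM, hLM⟩
    exact hv (M.comap (φ g : W →* W)) ⟨hM.comap_of_normal g,
      fun x hx => hLM (hL.invariant g x hx)⟩
  have hLJ : L ≤ J := le_sInf fun M hM => hM.2
  obtain ⟨M, hLM, hM⟩ := exists_le_isMaxInvariant hLA hL.ne_top
  have hwJ : w ∈ J := mem_sInf.2 fun M hM => hw M hM.1
  rcases hL.eq_or_eq_top J hJ hLJ with h0 | h0
  · exact h0 ▸ hwJ
  · exact absurd (top_le_iff.1 (h0 ▸ sInf_le ⟨hM, hLM⟩)) hM.ne_top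

/-- Since `B` is abelian, the fixed points of any element form an invariant subgroup. An element
fixing one nonzero vector of the irreducible quotient thus acts trivially there, and `B` modulo the
kernel injects into the orbit of that vector. -/
theorem IsMaxInvariant.index_ker_le [Finite W] (hB : ∀ a b : B, a * b = b * a) {L : Subgroup W}
    (hL : IsMaxInvariant φ L) : (quotientAction φ L hL.invariant).ker.index ≤ L.index := by
  obtain ⟨w, hw⟩ : ∃ w, w ∉ L := by
    by_contra! hcon
    exact hL.ne_top (eq_top_iff.2 fun v _ => hcon v)
  set ψ := quotientAction φ L hL.invariant with hψ
  refine index_le_card_of_forall (fun a => ψ a (w : W ⧸ L)) fun a b hab => ?_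
  have hc : ψ (a⁻¹ * b) (w : W ⧸ L) = (w : W ⧸ L) := by
    rw [map_mul, map_inv, MulAut.mul_apply, ← hab, MulAut.inv_apply_self]
  let Fx : Subgroup (W ⧸ L) :=
    { carrier := {v | ψ (a⁻¹ * b) v = v}
      one_mem' := map_one _
      mul_mem' := fun {x y} (hx : ψ _ x = x) (hy : ψ _ y = y) => by
        change ψ _ (x * y) = x * y
        rw [map_mul, hx, hy]
      inv_mem' := fun {x} (hx : ψ _ x = x) => by
        change ψ _ x⁻¹ = x⁻¹
        rw [map_inv, hx] }
  have hinv : IsInvariantUnder ψ Fx := by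
    intro g v (hv : ψ _ v = v)
    change ψ _ (ψ g v) = ψ g v
    rw [← MulAut.mul_apply, ← map_mul, hB, map_mul, MulAut.mul_apply, hv]
  rcases hL.isIrreducibleAction.eq_bot_or_eq_top Fx hinv with h0 | h0
  · have h1 : (w : W ⧸ L) ∈ Fx := hc
    rw [h0, mem_bot, QuotientGroup.eq_one_iff] at h1
    exact absurd h1 hw
  · rw [MonoidHom.mem_ker]
    ext v
    have h1 : v ∈ Fx := h0 ▸ mem_top v
    exact h1

/-- An abelian group acting faithfully on a finite abelian group `W`, so that the maximal invariant
subgroups of `W` intersect trivially, has order at most that of `W`. -/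
theorem card_le_of_comm_of_maxInvariant [Finite W] [Finite B] (hB : ∀ a b : B, a * b = b * a)
    (hφ : Function.Injective φ) (hW : ∀ w, (∀ L, IsMaxInvariant φ L → w ∈ L) → w = 1) :
    Nat.card B ≤ Nat.card W := by
  classical
  -- Intersecting with a new `L` that does not contain `I` multiplies the index exactly, since `L ⊔
  -- I = ⊤` by maximality, while the index of `K` grows by a factor of at most `L.index`.
  have key : ∀ S : Finset (Subgroup W), (∀ L ∈ S, IsMaxInvariant φ L) →
      IsInvariantUnder φ (S.inf id) ∧
      ∃ K : Subgroup B, (∀ a ∈ K, ∀ w, (φ a w)⁻¹ * w ∈ S.inf id) ∧ K.index ≤ (S.inf id).index := by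
    intro S
    induction S using Finset.induction_on with
    | empty => exact fun _ => ⟨fun _ _ _ => mem_top _, ⊤, fun _ _ _ => mem_top _, by simp⟩
    | insert L S _ ih =>
      intro hS
      have hL := hS L (Finset.mem_insert_self L S)
      obtain ⟨hI, K, hK, hKi⟩ := ih fun M hM => hS M (Finset.mem_insert_of_mem hM)
      rw [Finset.inf_insert, id_eq]
      generalize S.inf id = I at *
      refine ⟨fun g v hv => ⟨hL.invariant g v hv.1, hI g v hv.2⟩, ?_⟩
      by_cases hle : I ≤ L
      · exact ⟨K, by simpa [inf_eq_right.2 hle] using hK, by simpa [inf_eq_right.2 hle] using hKi⟩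
      · refine ⟨(quotientAction φ L hL.invariant).ker ⊓ K, fun a ha w =>
          ⟨(quotientAction_eq_one_iff hL.invariant).1 ha.1 w, hK a ha.2 w⟩, ?_⟩
        have hsup : L ⊔ I = ⊤ := by
          refine (hL.eq_or_eq_top (L ⊔ I) ?_ le_sup_left).resolve_left
            fun h => hle (h ▸ le_sup_right)
          intro g v hv
          obtain ⟨x, hx, y, hy, rfl⟩ := mem_sup.1 hv
          rw [map_mul]
          exact mul_mem_sup (hL.invariant g x hx) (hI g y hy)
        have hidx : (L ⊓ I).index = L.index * I.index := by
          rw [← relIndex_mul_index (inf_le_right : L ⊓ I ≤ I), inf_relIndex_right,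
            ← relIndex_sup_left, hsup, relIndex_top_right]
        rw [hidx]
        exact index_inf_le.trans (Nat.mul_le_mul (hL.index_ker_le hB) hKi)
  obtain ⟨-, K, hK, hKi⟩ := key (Set.toFinite {L | IsMaxInvariant φ L}).toFinset (by simp)
  have hbot : (Set.toFinite {L | IsMaxInvariant φ L}).toFinset.inf id = ⊥ := by
    rw [eq_bot_iff]
    intro w hw
    refine hW w fun L hL => ?_
    exact (Finset.inf_le (f := id) (by simpa using hL) : _ ≤ id L) hw
  rw [hbot] at hK hKi
  have hKb : K = ⊥ := by
    rw [eq_bot_iff]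
    intro a ha
    rw [mem_bot, ← map_eq_one_iff φ hφ]
    ext w
    exact inv_mul_eq_one.1 (hK a ha w)
  rwa [hKb, index_bot, index_bot] at hKi

end MaxInvariant

/-! ### Sections of affine cyclic type. -/

theorem isSectionOf_of_ker_le {S : Type*} {Q G : Type u} [Group S] [Group Q] [Group G] (α : S →* G)
    (β : S →* Q) (hβ : Function.Surjective β) (hker : α.ker ≤ β.ker) : IsSectionOf Q G := by
  let γ : α.range →* Q :=
    (QuotientGroup.lift α.ker β hker).comp (QuotientGroup.quotientKerEquivRange α).symm.toMonoidHom
  have hγ : Function.Surjective γ := by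
    intro q
    obtain ⟨s, rfl⟩ := hβ q
    exact ⟨QuotientGroup.quotientKerEquivRange α (s : S ⧸ α.ker), by simp [γ]⟩
  exact ⟨α.range, γ.ker, inferInstance, ⟨QuotientGroup.quotientKerEquivOfSurjective γ hγ⟩⟩

section Section

variable {G E : Type u} [Group G] [CommGroup E] {F : Subgroup G} [F.Normal]
  {θ : F →* E} {φ : G →* MulAut E} {p : ℕ}

/-- If `E` is an elementary abelian quotient of a normal subgroup, compatibly with the action of
`G`, and `x` has order prime to the exponent of `E`, then the semidirect product of `E` and the
group induced by `x` on `E` is a section of `G`. -/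
theorem isSectionOf_semidirectProduct (hθ : Function.Surjective θ)
    (hφ : ∀ g x, θ (MulAut.conjNormal g x) = φ g (θ x)) (hE : ∀ v : E, v ^ p = 1) {x : G}
    (hx : (orderOf x).Coprime p) :
    IsSectionOf (E ⋊[(zpowers (φ x)).subtype] (zpowers (φ x))) G := by
  let α : F ⋊[(MulAut.conjNormal : G →* MulAut F).comp (zpowers x).subtype] (zpowers x) →* G :=
    SemidirectProduct.lift F.subtype (zpowers x).subtype (by
      intro g
      ext y
      simp)
  let fg : zpowers x →* zpowers (φ x) :=
    (φ.comp (zpowers x).subtype).codRestrict (zpowers (φ x)) (by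
      rintro ⟨_, k, rfl⟩
      exact ⟨k, by simp⟩)
  let β : F ⋊[(MulAut.conjNormal : G →* MulAut F).comp (zpowers x).subtype] (zpowers x) →*
      E ⋊[(zpowers (φ x)).subtype] (zpowers (φ x)) :=
    SemidirectProduct.map θ fg (by
      intro g
      ext y
      exact hφ g y)
  refine isSectionOf_of_ker_le α β ?_ ?_
  · rintro ⟨v, ⟨_, k, rfl⟩⟩
    obtain ⟨y, rfl⟩ := hθ v
    refine ⟨⟨y, ⟨x ^ k, k, rfl⟩⟩, ?_⟩
    refine SemidirectProduct.ext rfl (Subtype.ext ?_)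
    change φ (x ^ k) = φ x ^ k
    rw [map_zpow]
  -- A kernel element of `α` has `y = c⁻¹` in `F ∩ ⟨x⟩`. The order of `θ y` divides both `p` and the
  -- order of `x`, so `θ y = 1`; and `y` acts on the abelian group `E` as conjugation by `θ y`, that
  -- is, trivially.
  · rintro ⟨y, c⟩ hyc
    have h1 : (y : G) * c = 1 := hyc
    have hy : (y : G) = (c : G)⁻¹ := eq_inv_of_mul_eq_one_left h1
    have h2 : y ^ orderOf x = 1 := by
      obtain ⟨k, hk⟩ := c.2
      refine Subtype.ext ?_
      rw [coe_pow, hy, ← hk]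
      change (x ^ k)⁻¹ ^ orderOf x = 1
      rw [inv_pow, ← zpow_natCast, ← zpow_mul, mul_comm, zpow_mul, zpow_natCast, pow_orderOf_eq_one,
        one_zpow, inv_one]
    have h3 : θ y = 1 := by
      have h4 : orderOf (θ y) ∣ orderOf x :=
        orderOf_dvd_of_pow_eq_one (by rw [← map_pow, h2, map_one])
      have h5 : orderOf (θ y) ∣ p := orderOf_dvd_of_pow_eq_one (hE _)
      exact orderOf_eq_one_iff.1 (Nat.eq_one_of_dvd_coprimes hx h4 h5)
    have h6 : φ y = 1 := by
      ext v
      obtain ⟨z, rfl⟩ := hθ v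
      rw [← hφ, (Subtype.ext (by simp) : MulAut.conjNormal (y : G) z = y * z * y⁻¹), map_mul,
        map_mul, map_inv, mul_inv_cancel_comm]
      rfl
    rw [MonoidHom.mem_ker]
    refine SemidirectProduct.ext h3 (Subtype.ext ?_)
    change φ c = 1
    rw [hy, map_inv, inv_eq_one] at h6
    exact h6

/-- It suffices that each prime power `q ^ k` dividing the order of `φ g` is at most `T`. The
`q`-part of `g` induces on `E` a cyclic group of `q`-power order divisible by `q ^ k`, and this
group gives an affine section. -/
theorem pow_factorial_eq_one_of_no_section [Finite G] [Finite E] (hp : p.Prime)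
    (hθ : Function.Surjective θ)
    (hφ : ∀ g x, θ (MulAut.conjNormal g x) = φ g (θ x)) (hE : ∀ v : E, v ^ p = 1) {T : ℕ}
    (hT : ¬ ∃ (E C : Type u) (_ : Group E) (_ : Group C) (φ : C →* MulAut E),
      IsAffineCyclicType φ ∧ T < Nat.card C ∧ IsSectionOf (E ⋊[φ] C) G) {g : G} {m : ℕ}
    (hm : p.Coprime m) (hg : φ g ^ m = 1) : φ g ^ T.factorial = 1 := by
  rw [← orderOf_dvd_iff_pow_eq_one, Nat.dvd_iff_prime_pow_dvd_dvd]
  intro q k hq hqk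
  rcases Nat.eq_zero_or_pos k with rfl | hk
  · simp
  have hqm : q ∣ m := (dvd_pow_self q hk.ne').trans (hqk.trans (orderOf_dvd_of_pow_eq_one hg))
  have hqp : q.Coprime p := (hm.coprime_dvd_right hqm).symm
  set n := orderOf g with hn
  have hn0 : n ≠ 0 := (orderOf_pos g).ne'
  -- The `q`-part is taken in `G` rather than in the automorphism group, so that `x` itself has
  -- order prime to `p`.
  set x := g ^ (n / q ^ n.factorization q) with hx
  have hxo : orderOf x ∣ q ^ n.factorization q := by
    refine orderOf_dvd_of_pow_eq_one ?_
    rw [hx, ← pow_mul, Nat.div_mul_cancel (Nat.ordProj_dvd n q), hn, pow_orderOf_eq_one]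
  have hdvd : q ^ k ∣ orderOf (φ x) := by
    rw [hx, map_pow, orderOf_pow]
    refine Nat.dvd_div_of_mul_dvd ?_
    refine Nat.Coprime.mul_dvd_of_dvd_of_dvd ?_ (Nat.gcd_dvd_left _ _) hqk
    exact (((Nat.coprime_ordCompl hq hn0).pow_left k).symm).coprime_dvd_left (Nat.gcd_dvd_right _ _)
  have hcard : Nat.card (zpowers (φ x)) = orderOf (φ x) := Nat.card_zpowers _
  have hox : orderOf (φ x) ∣ q ^ n.factorization q := (orderOf_map_dvd φ x).trans hxo
  obtain ⟨j, -, hj⟩ := (Nat.dvd_prime_pow hq).1 hox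
  have hj0 : j ≠ 0 := by
    rintro rfl
    rw [hj, pow_zero, Nat.dvd_one, Nat.pow_eq_one] at hdvd
    rcases hdvd with h | h
    · exact hq.ne_one h
    · exact hk.ne' h
  have hle : orderOf (φ x) ≤ T := by
    by_contra! hlt
    refine hT ⟨E, zpowers (φ x), inferInstance, inferInstance, (zpowers (φ x)).subtype, ?_,
      hcard ▸ hlt, isSectionOf_semidirectProduct hθ hφ hE ?_⟩
    · refine ⟨inferInstance, mul_comm, ⟨p, hp, hE, ?_⟩, inferInstance, ?_, subtype_injective _⟩
      · rw [hcard, hj, ← Nat.Prime.coprime_iff_not_dvd hp]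
        exact (hqp.pow_left j).symm
      · rw [hcard, hj]
        exact hq.isPrimePow.pow hj0
    · exact ((hqp.pow_left _).coprime_dvd_left hxo)
  exact Nat.dvd_factorial (pow_pos hq.pos k) ((Nat.le_of_dvd (orderOf_pos _) hdvd).trans hle)

end Section

/-! ### Combining the bounds. -/

/-- The bound for the index of a maximal abelian normal subgroup. -/
def abelianIndexBound (r : ℕ) : ℕ :=
  ((r ^ 2).factorial ^ r * (r ^ 2).factorial ^ r) ^ r *
    ((r ^ 2).factorial ^ r) ^ (r ^ 2).factorial

/-- Here `W` stands for `F(G)/Φ(G)`; only its commutativity and the faithful semisimple action of `G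
⧸ F` matter. -/
theorem exists_abelian_normal_of_maxInvariant {G W : Type u} [Group G] [Finite G]
    [Group.IsSolvable G] {F : Subgroup G} [F.Normal] [CommGroup W] [Finite W] {θ : F →* W}
    {φ : G ⧸ F →* MulAut W} (hθ : Function.Surjective θ)
    (hθφ : ∀ (g : G) x, θ (MulAut.conjNormal g x) = φ g (θ x)) (hφ : Function.Injective φ)
    (hW : ∀ w, (∀ L, IsMaxInvariant φ L → w ∈ L) → w = 1) {r : ℕ} (hr : HasRankLE G r) :
    ∃ A : Subgroup (G ⧸ F), A.Normal ∧ IsMulCommutative A ∧ Nat.card A ≤ Nat.card W ∧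
      A.index ≤ abelianIndexBound r ∧
      ∀ T : ℕ,
        (¬ ∃ (E C : Type u) (_ : Group E) (_ : Group C) (φ : C →* MulAut E),
          IsAffineCyclicType φ ∧ T < Nat.card C ∧ IsSectionOf (E ⋊[φ] C) G) →
        Nat.card A ≤ T.factorial ^ r := by
  have hB : HasRankLE (G ⧸ F) r := hr.quotient F
  have hfam := isFaithfulIrreducibleFamily_of_maxInvariant hφ
    ((hr.subgroup F).of_surjective θ hθ) hW
  obtain ⟨A, hA⟩ := (Set.toFinite {A : Subgroup (G ⧸ F) | A.Normal ∧
    A ≤ centralizer (A : Set (G ⧸ F))}).exists_maximal ⟨⊥, inferInstance, bot_le⟩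
  obtain ⟨⟨hAn, hAc⟩, hAmax⟩ := hA
  have hcomm : ∀ x y : A, x * y = y * x := fun x y => Subtype.ext (hAc y.2 x x.2)
  refine ⟨A, hAn, le_centralizer_iff_isMulCommutative.1 hAc, ?_, ?_, fun T hT => ?_⟩
  · exact card_le_of_comm_of_maxInvariant (φ := φ.comp A.subtype) hcomm
      (hφ.comp A.subtype_injective) (eq_one_of_forall_maxInvariant_normal A hW)
  · exact hfam.index_le hB hAc fun A' hA'n hA'c hle => le_antisymm (hAmax ⟨hA'n, hA'c⟩ hle) hle
  · refine (hB.subgroup A).card_le_of_comm hcomm (Nat.factorial_pos T) fun a => Subtype.ext ?_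
    have hnil : Group.IsNilpotent A := isNilpotent_of_commutator_le (commutator_le_left A A) hAc
    refine hfam.faithful _ fun L => ?_
    obtain ⟨p, hp, hV⟩ := (hfam.irreducible L).exists_prime
    obtain ⟨m, hm, hmA⟩ := (hfam.irreducible L).exists_pow_eq_one hp hV A
    obtain ⟨g, hg⟩ := QuotientGroup.mk'_surjective F (a : G ⧸ F)
    rw [coe_pow, map_pow, ← hg]
    refine pow_factorial_eq_one_of_no_section (F := F)
      (θ := (QuotientGroup.mk' L.1).comp θ)
      (φ := (quotientAction φ L.1 L.2.invariant).comp (QuotientGroup.mk' F)) hp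
      ((QuotientGroup.mk'_surjective L.1).comp hθ) ?_ hV hT hm ?_
    · intro g x
      exact congrArg (QuotientGroup.mk' L.1) (hθφ g x)
    · rw [MonoidHom.comp_apply, hg]
      exact hmA _ a.2

/-! ### The Fitting and Frattini subgroups. -/

section Fitting

variable {G : Type*} [Group G]

/-- A nilpotent normal subgroup centralizes chief factors: otherwise `K = L ⊔ ⁅K, N⁆`, and iterating
puts `K` inside `L` times every term of the lower central series of `N`. -/
theorem commutator_le_of_isNilpotent {K L N : Subgroup G} [K.Normal] [L.Normal] [N.Normal]
    [hN : Group.IsNilpotent N] (hLK : L < K)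
    (hmax : ∀ L' : Subgroup G, L'.Normal → L ≤ L' → L' ≤ K → L' = L ∨ L' = K) : ⁅K, N⁆ ≤ L := by
  rcases hmax (L ⊔ ⁅K, N⁆) inferInstance le_sup_left
    (sup_le hLK.le (commutator_le_left K N)) with h | h
  · exact h ▸ le_sup_right
  · exfalso
    have key : ∀ n, K ≤ L ⊔ N.lowerCentralSeries n := by
      intro n
      induction n with
      | zero =>
        nth_rewrite 1 [← h]
        exact sup_le_sup_left (commutator_le_right K N) L
      | succ n ih =>
        nth_rewrite 1 [← h]
        refine sup_le le_sup_left ((commutator_mono ih le_rfl).trans ?_)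
        exact commutator_sup_le ((commutator_le_left L N).trans le_sup_left) le_sup_right
    obtain ⟨n, hn⟩ := (isNilpotent_iff_lowerCentralSeries _).1 hN
    have := key n
    rw [hn, sup_bot_eq] at this
    exact hLK.not_ge this

/-- All generators of `F(G)` centralize each chief factor, hence so does `F(G)`. Its commutator with
a nontrivial normal subgroup is thus strictly smaller, which forces the lower central series down to
`⊥`. -/
theorem fittingSubgroup_isNilpotent [Finite G] : Group.IsNilpotent (fittingSubgroup G) := by
  have hlt : ∀ K : Subgroup G, K.Normal → K ≠ ⊥ → ⁅K, fittingSubgroup G⁆ < K := by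
    intro K hK hne
    obtain ⟨L, hL⟩ := (Set.toFinite {L : Subgroup G | L.Normal ∧ L < K}).exists_maximal
      ⟨⊥, inferInstance, bot_lt_iff_ne_bot.2 hne⟩
    obtain ⟨⟨hLn, hLK⟩, hLmax⟩ := hL
    refine lt_of_le_of_lt ?_ hLK
    rw [commutator_comm, commutator_le_iff_le_comap_centralizer]
    refine sSup_le fun N hN => ?_
    have := hN.1
    have := hN.2
    rw [← commutator_le_iff_le_comap_centralizer, commutator_comm]
    refine commutator_le_of_isNilpotent hLK fun L' hL' hle hle' => ?_
    rcases hle'.lt_or_eq with h | h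
    · exact Or.inl (le_antisymm (hLmax ⟨hL', h⟩ hle) hle)
    · exact Or.inr h
  obtain ⟨K, ⟨n, rfl⟩, hmin⟩ := (Set.toFinite
    (Set.range (fittingSubgroup G).lowerCentralSeries)).exists_minimal (Set.range_nonempty _)
  refine isNilpotent_of_lowerCentralSeries_eq_bot (n := n) ?_
  by_contra hne
  have h1 := hlt _ inferInstance hne
  exact h1.not_ge (hmin ⟨n + 1, rfl⟩ h1.le)

theorem le_fittingSubgroup {N : Subgroup G} (hn : N.Normal) (hN : Group.IsNilpotent N) :
    N ≤ fittingSubgroup G :=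
  le_sSup ⟨hn, hN⟩

theorem frattini_le_fittingSubgroup [Finite G] : frattini G ≤ fittingSubgroup G :=
  le_fittingSubgroup inferInstance frattini_nilpotent

/-- Gaschütz: a normal subgroup that is nilpotent modulo the Frattini subgroup is nilpotent. -/
theorem isNilpotent_of_map_frattini [Finite G] {N : Subgroup G} [N.Normal] (hle : frattini G ≤ N)
    (hN : Group.IsNilpotent (N.map (QuotientGroup.mk' (frattini G)))) : Group.IsNilpotent N := by
  refine (Group.isNilpotent_of_finite_tfae (G := N).out 0 3 rfl rfl).2 fun p hp P => ?_
  let f := QuotientGroup.mk' (frattini G)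
  let Pb : Sylow p (N.map f) := P.mapSurjective (f.subgroupMap_surjective N)
  have hPbn : (Pb : Subgroup (N.map f)).Normal :=
    (Group.isNilpotent_of_finite_tfae.out 0 3 rfl rfl).1 hN p hp Pb
  have hPbc : (Pb : Subgroup (N.map f)).Characteristic := Pb.characteristic_of_normal hPbn
  have hNn : (N.map f).Normal := ‹N.Normal›.map f (QuotientGroup.mk'_surjective _)
  have hPbG : ((Pb : Subgroup (N.map f)).map (N.map f).subtype).Normal := inferInstance
  set Q := (P : Subgroup N).map N.subtype with hQ
  have hPbQ : (Pb : Subgroup (N.map f)).map (N.map f).subtype = Q.map f := by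
    rw [Sylow.coe_mapSurjective, hQ, map_map, map_map]
    rfl
  rw [hPbQ] at hPbG
  -- The image of `Q` is characteristic in the normal image of `N`, so `QΦ` is normal in `G`.
  have hR : (Q.map f).comap f = Q ⊔ frattini G := by
    rw [comap_map_eq, QuotientGroup.ker_mk']
  have hRn : (Q ⊔ frattini G).Normal := hR ▸ hPbG.comap f
  set R := Q ⊔ frattini G with hRdef
  have hQN : Q ≤ N := map_subtype_le _
  have hRN : R ≤ N := sup_le hQN hle
  have hQR : Q ≤ R := le_sup_left
  have hQp : IsPGroup p (Q.subgroupOf R) := (P.2.map N.subtype).comap_subtype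
  have hdvd : ¬ p ∣ (Q.subgroupOf R).index := by
    intro h
    have h1 : Q.relIndex R ∣ Q.relIndex N :=
      ⟨_, (relIndex_mul_relIndex Q R N hQR hRN).symm⟩
    have h2 : Q.subgroupOf N = P := by
      rw [hQ, subgroupOf, comap_map_eq_self_of_injective N.subtype_injective]
    have h3 : p ∣ Q.relIndex N := dvd_trans h h1
    rw [relIndex, h2] at h3
    exact P.not_dvd_index h3
  -- The Frattini argument for `Q` in `QΦ`; as `Φ` consists of nongenerators, the normalizer of `Q`
  -- is all of `G`.
  have h4 := Sylow.normalizer_sup_eq_top (hQp.toSylow hdvd)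
  have h5 : ((hQp.toSylow hdvd : Sylow p R) : Subgroup R).map R.subtype = Q := by
    rw [IsPGroup.toSylow_coe, map_subgroupOf_eq_of_le hQR]
  rw [h5] at h4
  have h6 : normalizer (Q : Set G) ⊔ frattini G = ⊤ := by
    rw [eq_top_iff, ← h4]
    exact sup_le le_sup_left (sup_le (le_normalizer.trans le_sup_left) le_sup_right)
  have h7 : Q.Normal := normalizer_eq_top_iff.1 (frattini_nongenerating h6)
  exact h7.of_map_subtype

/-- In a finite soluble group, an element that centralizes the Fitting subgroup modulo the
Frattini subgroup lies in the Fitting subgroup. -/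
theorem mem_fittingSubgroup_of_commutator_mem [Finite G] [Group.IsSolvable G]
    (hF : ⁅fittingSubgroup G, fittingSubgroup G⁆ ≤ frattini G) {g : G}
    (hg : ∀ x ∈ fittingSubgroup G, g * x * g⁻¹ * x⁻¹ ∈ frattini G) : g ∈ fittingSubgroup G := by
  set F := fittingSubgroup G with hFdef
  let D := (centralizer (F.map (QuotientGroup.mk' (frattini G)) : Set (G ⧸ frattini G))).comap
    (QuotientGroup.mk' (frattini G))
  have hFn : (F.map (QuotientGroup.mk' (frattini G))).Normal :=
    (fittingSubgroup_normal G).map _ (QuotientGroup.mk'_surjective _)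
  have hDn : D.Normal := inferInstance
  have hDF : D ≤ F := by
    by_contra hcon
    obtain ⟨M, hMn, hMD, hMF, hMM⟩ := exists_normal_commutator_le hcon
    -- Modulo `Φ`, the group `M F` has its derived subgroup inside the central subgroup `F/Φ`, so `M
    -- F` is nilpotent by Gaschütz and lies in `F`.
    refine hMF (le_sup_left.trans (le_fittingSubgroup (N := M ⊔ F) inferInstance ?_))
    have hMF' : ⁅M, F⁆ ≤ frattini G := commutator_le_iff_le_comap_centralizer.2 hMD
    have hΦF : frattini G ≤ F := frattini_le_fittingSubgroup
    refine isNilpotent_of_map_frattini (hΦF.trans le_sup_right) ?_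
    refine isNilpotent_of_commutator_le (A := F.map (QuotientGroup.mk' (frattini G))) ?_ ?_
    · rw [← map_commutator]
      refine map_mono ?_
      have h3 : ∀ K : Subgroup G, ⁅M, K⁆ ≤ F → ⁅F, K⁆ ≤ F → ⁅M ⊔ F, K⁆ ≤ F :=
        fun K => commutator_sup_le
      refine h3 _ ?_ ?_ <;> rw [commutator_comm]
      · exact h3 _ hMM (commutator_le_left F M)
      · exact h3 _ (hMF'.trans hΦF) (commutator_le_left F F)
    · rw [map_le_iff_le_comap, ← commutator_le_iff_le_comap_centralizer, commutator_comm]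
      exact commutator_sup_le hMF' hF
  refine hDF ?_
  rintro _ ⟨x, hx, rfl⟩
  have h1 := hg x hx
  rw [← QuotientGroup.eq_one_iff, ← QuotientGroup.mk'_apply, map_mul, map_mul, map_mul, map_inv,
    map_inv, mul_inv_eq_one, mul_inv_eq_iff_eq_mul] at h1
  exact h1.symm

/-- A maximal subgroup meets a nilpotent normal subgroup not contained in it in a normal
subgroup. -/
theorem inf_normal_of_isCoatom {M F : Subgroup G} [hFn : F.Normal] [Group.IsNilpotent F]
    (hM : IsCoatom M) (hFM : ¬ F ≤ M) : (M ⊓ F).Normal := by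
  have hlt : M.subgroupOf F < ⊤ := by
    rw [lt_top_iff_ne_top, Ne, subgroupOf_eq_top]
    exact hFM
  -- Normalizers grow in `F`, so `M ∩ F` is normalized by `M` and by an element outside `M`, hence
  -- by `G`.
  have h1 := Group.normalizerCondition_of_isNilpotent (G := F) _ hlt
  obtain ⟨y, hy, hyM⟩ := SetLike.exists_of_lt h1
  have hMn : M ≤ normalizer ((M ⊓ F : Subgroup G) : Set G) := by
    intro m hm
    rw [mem_normalizer_iff]
    intro x
    refine and_congr ?_ ?_
    · exact ⟨fun h => M.mul_mem (M.mul_mem hm h) (M.inv_mem hm), fun h => by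
        simpa [mul_assoc] using M.mul_mem (M.mul_mem (M.inv_mem hm) h) hm⟩
    · exact ⟨fun h => hFn.conj_mem x h m, fun h => by
        simpa [mul_assoc] using hFn.conj_mem _ h m⁻¹⟩
  have hyn : (y : G) ∈ normalizer ((M ⊓ F : Subgroup G) : Set G) := by
    rw [mem_normalizer_iff] at hy ⊢
    intro x
    by_cases hx : x ∈ F
    · have := hy ⟨x, hx⟩
      simp only [mem_subgroupOf, coe_mul, coe_inv] at this
      exact and_congr this ⟨fun _ => F.mul_mem (F.mul_mem y.2 hx) (F.inv_mem y.2), fun _ => hx⟩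
    · refine ⟨fun h => absurd h.2 hx, fun h => absurd ?_ hx⟩
      simpa [mul_assoc] using F.mul_mem (F.mul_mem (F.inv_mem y.2) h.2) y.2
  refine normalizer_eq_top_iff.1 (hM.2 _ (lt_of_le_of_ne hMn ?_))
  intro h
  exact hyM (h ▸ hyn)

/-- If a maximal `M` misses `[F, F]`, then `F = (M ∩ F)[F, F]` with `M ∩ F` normal; iterating down
the lower central series gives `F ≤ M`, a contradiction. -/
theorem commutator_fittingSubgroup_le [Finite G] :
    ⁅fittingSubgroup G, fittingSubgroup G⁆ ≤ frattini G := by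
  have hFnil := fittingSubgroup_isNilpotent (G := G)
  set F := fittingSubgroup G
  have hFn : F.Normal := fittingSubgroup_normal G
  refine le_iInf₂ fun M hM => ?_
  by_cases hFM : F ≤ M
  · exact (commutator_le_left F F).trans hFM
  by_contra hcon
  have hsup : M ⊔ ⁅F, F⁆ = ⊤ :=
    hM.2 _ (lt_of_le_of_ne le_sup_left fun h => hcon (h ▸ le_sup_right))
  have hn := inf_normal_of_isCoatom hM hFM
  have key : ∀ n, F ≤ (M ⊓ F) ⊔ F.lowerCentralSeries n := by
    intro n
    induction n with
    | zero => exact le_sup_right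
    | succ n ih =>
      have h1 : F ≤ (M ⊓ F) ⊔ ⁅F, F⁆ := by
        intro x hx
        obtain ⟨m, hm, c, hc, rfl⟩ := mem_sup_of_normal_right.1 (hsup ▸ mem_top x)
        have hcF : c ∈ F := commutator_le_left F F hc
        exact mul_mem_sup ⟨hm, (F.mul_mem_cancel_right hcF).1 hx⟩ hc
      refine h1.trans (sup_le le_sup_left ((commutator_mono ih le_rfl).trans ?_))
      exact commutator_sup_le ((commutator_le_left _ F).trans le_sup_left) le_sup_right
  obtain ⟨n, hn'⟩ := (isNilpotent_iff_lowerCentralSeries _).1 hFnil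
  have := key n
  rw [hn', sup_bot_eq] at this
  exact hFM (this.trans inf_le_left)

end Fitting

/-! ### The faithful semisimple action on `F(G)/Φ(G)`. -/

section FittingQuotient

/-- The quotient of the Fitting subgroup by the Frattini subgroup. -/
abbrev FittingQuotient (G : Type u) [Group G] : Type u :=
  fittingSubgroup G ⧸ (frattini G).subgroupOf (fittingSubgroup G)

variable {G : Type u} [Group G]

theorem FittingQuotient.mul_comm [Finite G] (x y : FittingQuotient G) : x * y = y * x := by
  induction x using QuotientGroup.induction_on with | H x =>
  induction y using QuotientGroup.induction_on with | H y =>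
  rw [← QuotientGroup.mk_mul, ← QuotientGroup.mk_mul, QuotientGroup.eq, mem_subgroupOf]
  have h1 := commutator_fittingSubgroup_le
    (commutator_mem_commutator (inv_mem y.2) (inv_mem x.2))
  rw [commutatorElement_def] at h1
  simpa [mul_assoc] using h1

/-- The Fitting subgroup modulo the Frattini subgroup, as a commutative group. -/
@[reducible]
def FittingQuotient.commGroup (G : Type u) [Group G] [Finite G] : CommGroup (FittingQuotient G) :=
  { (inferInstance : Group (FittingQuotient G)) with mul_comm := FittingQuotient.mul_comm }

theorem isInvariantUnder_conjNormal_frattini (G : Type u) [Group G] :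
    IsInvariantUnder (MulAut.conjNormal : G →* MulAut (fittingSubgroup G))
      ((frattini G).subgroupOf (fittingSubgroup G)) := by
  intro g x hx
  rw [mem_subgroupOf] at *
  rw [MulAut.conjNormal_apply]
  exact Normal.conj_mem inferInstance _ hx g

/-- The conjugation action of `G` on `F(G) / Φ(G)`. -/
def conjFittingQuotient (G : Type u) [Group G] : G →* MulAut (FittingQuotient G) :=
  quotientAction MulAut.conjNormal ((frattini G).subgroupOf (fittingSubgroup G))
    (isInvariantUnder_conjNormal_frattini G)

theorem conjFittingQuotient_eq_one_iff {g : G} : conjFittingQuotient G g = 1 ↔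
    ∀ x ∈ fittingSubgroup G, (g * x * g⁻¹)⁻¹ * x ∈ frattini G := by
  rw [conjFittingQuotient, quotientAction_eq_one_iff]
  simp only [mem_subgroupOf, Subtype.forall, coe_mul, coe_inv, MulAut.conjNormal_apply]

theorem fittingSubgroup_le_ker [Finite G] : fittingSubgroup G ≤ (conjFittingQuotient G).ker := by
  intro g hg
  rw [MonoidHom.mem_ker, conjFittingQuotient_eq_one_iff]
  intro x hx
  have h1 := commutator_fittingSubgroup_le
    (commutator_mem_commutator hg (inv_mem hx))
  rw [commutatorElement_def] at h1
  simpa [mul_assoc] using h1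

/-- The conjugation action of `G / F(G)` on `F(G) / Φ(G)`. -/
def fittingAction (G : Type u) [Group G] [Finite G] :
    G ⧸ fittingSubgroup G →* MulAut (FittingQuotient G) :=
  QuotientGroup.lift _ (conjFittingQuotient G) fittingSubgroup_le_ker

theorem fittingAction_mk [Finite G] (g : G) (x : fittingSubgroup G) :
    fittingAction G g (x : FittingQuotient G) = (MulAut.conjNormal g x : fittingSubgroup G) :=
  rfl

theorem fittingAction_injective [Finite G] [Group.IsSolvable G] :
    Function.Injective (fittingAction G) := by
  rw [injective_iff_map_eq_one]
  intro b hb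
  induction b using QuotientGroup.induction_on with | H g =>
  have h1 : conjFittingQuotient G g = 1 := hb
  rw [conjFittingQuotient_eq_one_iff] at h1
  rw [QuotientGroup.eq_one_iff]
  refine mem_fittingSubgroup_of_commutator_mem commutator_fittingSubgroup_le fun x hx => ?_
  have h2 := h1 x⁻¹ (inv_mem hx)
  simpa [mul_assoc] using h2

theorem mem_map_subgroupOf_iff {M : Subgroup G} (hM : frattini G ≤ M) (x : fittingSubgroup G) :
    (x : FittingQuotient G) ∈ (M.subgroupOf (fittingSubgroup G)).map
      (QuotientGroup.mk' ((frattini G).subgroupOf (fittingSubgroup G))) ↔ (x : G) ∈ M := by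
  constructor
  · rintro ⟨y, hy, hyx⟩
    have h1 : (y : G)⁻¹ * x ∈ M := hM (mem_subgroupOf.1 (QuotientGroup.eq.1 hyx))
    exact (M.mul_mem_cancel_left (M.inv_mem hy)).1 h1
  · exact fun hx => ⟨x, hx, rfl⟩

/-- An invariant subgroup of `F/Φ` lifts to a normal subgroup `R` of `G`. Either `R ≤ M`, or `M R =
G`; in the latter case, if `R` contains `M ∩ F`, then `R = F`. -/
theorem isMaxInvariant_map_of_isCoatom [Finite G] {M : Subgroup G} (hM : IsCoatom M)
    (hFM : ¬ fittingSubgroup G ≤ M) :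
    IsMaxInvariant (fittingAction G) ((M.subgroupOf (fittingSubgroup G)).map
      (QuotientGroup.mk' ((frattini G).subgroupOf (fittingSubgroup G)))) := by
  have hΦ : frattini G ≤ M := frattini_le_coatom hM
  have hnil := fittingSubgroup_isNilpotent (G := G)
  have hn := inf_normal_of_isCoatom hM hFM
  refine ⟨?_, ?_, fun L' hL' hle => ?_⟩
  · intro b w hw
    induction b using QuotientGroup.induction_on with | H g =>
    induction w using QuotientGroup.induction_on with | H x =>
    rw [mem_map_subgroupOf_iff hΦ] at hw
    rw [fittingAction_mk, mem_map_subgroupOf_iff hΦ, MulAut.conjNormal_apply]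
    exact (hn.conj_mem x ⟨hw, x.2⟩ g).1
  · intro ht
    exact hFM fun x hx => (mem_map_subgroupOf_iff hΦ ⟨x, hx⟩).1 (ht ▸ mem_top _)
  · set R := (L'.comap (QuotientGroup.mk' ((frattini G).subgroupOf (fittingSubgroup G)))).map
      (fittingSubgroup G).subtype with hR
    have hRn : R.Normal := by
      refine ⟨?_⟩
      rintro _ ⟨x, hx, rfl⟩ g
      exact ⟨MulAut.conjNormal g x, hL' g (x : FittingQuotient G) hx, MulAut.conjNormal_apply g x⟩
    by_cases hRM : R ≤ M
    · left
      refine le_antisymm ?_ hle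
      intro w hw
      induction w using QuotientGroup.induction_on with | H x =>
      exact (mem_map_subgroupOf_iff hΦ x).2 (hRM ⟨x, hw, rfl⟩)
    · right
      have hsup : M ⊔ R = ⊤ :=
        hM.2 _ (lt_of_le_of_ne le_sup_left fun h => hRM (h ▸ le_sup_right))
      rw [eq_top_iff]
      intro w _
      induction w using QuotientGroup.induction_on with | H x =>
      obtain ⟨m, hm, _, ⟨y, hy, rfl⟩, hmy⟩ := mem_sup_of_normal_right.1 (hsup ▸ mem_top (x : G))
      have h1 : ((x * y⁻¹ : fittingSubgroup G) : G) ∈ M := by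
        rw [coe_mul, coe_inv, ← hmy]
        simpa using hm
      have h2 : ((x * y⁻¹ : fittingSubgroup G) : FittingQuotient G) ∈ L' :=
        hle ((mem_map_subgroupOf_iff hΦ _).2 h1)
      have h3 := L'.mul_mem h2 hy
      rw [QuotientGroup.mk'_apply, ← QuotientGroup.mk_mul, inv_mul_cancel_right] at h3
      exact h3

theorem eq_one_of_forall_maxInvariant_fittingAction [Finite G] (w : FittingQuotient G)
    (hw : ∀ L, IsMaxInvariant (fittingAction G) L → w ∈ L) : w = 1 := by
  induction w using QuotientGroup.induction_on with | H x =>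
  rw [QuotientGroup.eq_one_iff, mem_subgroupOf]
  have h1 : ∀ M : Subgroup G, IsCoatom M → (x : G) ∈ M := by
    intro M hM
    by_cases hFM : fittingSubgroup G ≤ M
    · exact hFM x.2
    · exact (mem_map_subgroupOf_iff (frattini_le_coatom hM) x).1
        (hw _ (isMaxInvariant_map_of_isCoatom hM hFM))
  have h2 : zpowers (x : G) ≤ frattini G :=
    le_iInf₂ fun M hM => by simpa using h1 M hM
  exact h2 (mem_zpowers _)

end FittingQuotient

theorem mainTheorem7 :
    ∃ f : ℕ → ℕ, ∀ (r : ℕ) (G : Type u) [Group G] [Finite G] [Group.IsSolvable G],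
      subgroupRank G = r →
        ∃ A : Subgroup (G ⧸ fittingSubgroup G),
          A.Normal ∧ IsMulCommutative A ∧
          Nat.card A ≤
            Nat.card (fittingSubgroup G ⧸ (frattini G).subgroupOf (fittingSubgroup G)) ∧
          A.index ≤ f r ∧
          ∀ T : ℕ,
            (¬ ∃ (E C : Type u) (_ : Group E) (_ : Group C) (φ : C →* MulAut E),
              IsAffineCyclicType φ ∧ T < Nat.card C ∧ IsSectionOf (E ⋊[φ] C) G) →
            Nat.card A ≤ T.factorial ^ r := by
  refine ⟨abelianIndexBound, ?_⟩
  rintro r G _ _ _ rfl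
  exact @exists_abelian_normal_of_maxInvariant G (FittingQuotient G) _ _ _ (fittingSubgroup G) _
    (FittingQuotient.commGroup G) _
    (QuotientGroup.mk' ((frattini G).subgroupOf (fittingSubgroup G))) (fittingAction G)
    (QuotientGroup.mk'_surjective _) (fun g x => (fittingAction_mk g x).symm)
    fittingAction_injective eq_one_of_forall_maxInvariant_fittingAction _
    (hasRankLE_subgroupRank G)
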